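/- **Setting.** A finite register $Q$ of qubits is coupled to a bath with arbitrary Hilbert space $\mathcal B$. The joint evolution during $[0,T]$ is governed by $H=H_S+H_B+H_{SB}$. The time-dependent system Hamiltonian $H_S$ realizes an ideal quantum circuit with a finite non-empty set of locations; each location (a gate, or an identity operation on an idle qubit) is executed on a set of qubits during a time interval $[a,b)\subseteq[0,T]$, and a qubit takes part in at most one location at a time. The bath Hamiltonian $H_B$ is an arbitrary (possibly unbounded, possibly time-dependent) self-adjoint operator that generates a strongly continuous unitary evolution of the bath. The system–bath coupling is $$H_{SB}(t)=\sum_{k\ge1}\frac1{k!}\sum_{i_1,\dots,i_k\in Q}H^{(k)}_{i_1,\dots,i_k}(t),$$ where $H^{(k)}_{i_1,\dots,i_k}(t)$ is bounded, self-adjoint, acts on the system qubits $i_1,\dots,i_k$ and arbitrarily on the bath, is invariant under permutations of the indices, and vanishes if two indices coincide. Let $t_0$ be the maximal duration of a location and, for $k\ge1$, $$\tilde\eta_1^{(k)}=\max_{i_1,\,t}\ \sum_{i_2,\dots,i_k}\big\|H^{(k)}_{i_1,i_2,\dots,i_k}(t)\big\|\,t_0 ,$$ the maximum being over all qubits $i_1$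 and all times $t\in[0,T]$. **Effective noise strength.** Expand the evolution operator $U$ over $[0,T]$ in powers of $H_{SB}$, to all orders (the time-ordered perturbation series about the evolution generated by $H_S+H_B$). For a set $\mathcal I_r$ of $r$ locations let $E(\mathcal I_r)$ be the sum of all terms of the expansion for which every location in $\mathcal I_r$ is faulty, i.e. at least one of the qubits at that location is struck at least once by a term of $H_{SB}$ while the location is executed. The noise has effective noise strength $\varepsilon$ if, for every $r$ and every set $\mathcal I_r$ of $r$ locations, the expansion defining $E(\mathcal I_r)$ converges strongly and $\|E(\mathcal I_r)\|\le\varepsilon^r$. **Theorem.** Suppose that each location acts on at most $m$ qubits and that, for some $\alpha\ge0$ and $f_1,f_2,\ldots\ge0$, $$\tilde\eta_1^{(k)}\le f_k\,\alpha^k\qquad\text{for all }k\ge1 .$$ Suppose also that the series $$g_k=\sum_{l=0}^\infty\frac{(k-1)!\,f_{k+l}\,(2\alpha)^l}{(k+l-1)!}\quad(k\ge1)\qquad\text{and}\qquad \sum_{k=1}^\infty\frac{g_k}{2\,k!}$$ converge. Then the noise has effective noise strength $\varepsilon$ with $$\varepsilon\le 2m\alpha\,\exp\Big(\sum_{k=1}^\infty\frac{g_k}{2\,k!}\Big),$$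 that is, $\|E(\mathcal I_r)\|\le\big(2m\alpha\exp(\sum_{k\ge1} g_k/(2\,k!))\big)^r$ for every set $\mathcal I_r$ of $r$ locations. -/

import Mathlib

open scoped ENNReal InnerProductSpace
open MeasureTheory

noncomputable section

namespace CorrelatedNoise

/-- Computational basis labels of a register of qubits `Q`. -/
abbrev Bits (Q : Type*) := Q → Fin 2

/-- The joint Hilbert space `(ℂ²)^{⊗ Q} ⊗ 𝓑` of the system qubits `Q` and the bath `𝓑`, realized
as the `ℓ²` direct sum of copies of `𝓑` indexed by the computational basis. -/
abbrev Joint (Q 𝓑 : Type*) := PiLp 2 (fun _ : Bits Q => 𝓑)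

/-- The operator on the joint space with bath-operator entries `A x y`, that is
`∑ x y, |x⟩⟨y| ⊗ A x y`. -/
def ofBlocks {Q 𝓑 : Type*} [Fintype Q] [DecidableEq Q]
    [NormedAddCommGroup 𝓑] [InnerProductSpace ℂ 𝓑]
    (A : Bits Q → Bits Q → (𝓑 →L[ℂ] 𝓑)) : Joint Q 𝓑 →L[ℂ] Joint Q 𝓑 :=
  (PiLp.continuousLinearEquiv 2 ℂ (fun _ : Bits Q => 𝓑)).symm.toContinuousLinearMap ∘L
    ContinuousLinearMap.pi (fun x => ∑ y, A x y ∘L PiLp.proj 2 (fun _ : Bits Q => 𝓑) y)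

lemma ofBlocks_apply {Q 𝓑 : Type*} [Fintype Q] [DecidableEq Q]
    [NormedAddCommGroup 𝓑] [InnerProductSpace ℂ 𝓑]
    (A : Bits Q → Bits Q → (𝓑 →L[ℂ] 𝓑)) (ψ : Joint Q 𝓑) (x : Bits Q) :
    ofBlocks A ψ x = ∑ y, A x y (ψ y) := by
  simp [ofBlocks]

/-- The array with entries `a x|_S y|_S` if `x` and `y` agree outside `S`, and `0` otherwise:
the array of the operator `a ⊗ 1`, where `a` acts on the qubits in `S` and `1` is the identity on
all other qubits. -/
def extendBlocks {Q R : Type*} [Fintype Q] [DecidableEq Q] [Zero R]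
    (S : Finset Q) (a : Bits S → Bits S → R) : Bits Q → Bits Q → R :=
  fun x y => if ∀ q, q ∉ S → x q = y q then a (fun q => x q) (fun q => y q) else 0

/-- A quantum circuit on the qubits `Q` with locations `Loc`, run during the time interval
`[0, T]`.  Location `ℓ` is an operation on the qubits `qubits ℓ` executed during the time interval
`[startTime ℓ, endTime ℓ)` by a Hamiltonian `gate ℓ` (an idle qubit being a location with
`gate ℓ = 0`). A qubit takes part in at most one operation at a time. -/
structure Circuit (Q Loc : Type*) [Fintype Q] [DecidableEq Q] where
  T : ℝ
  qubits : Loc → Finset Q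
  startTime : Loc → ℝ
  endTime : Loc → ℝ
  startTime_nonneg : ∀ ℓ, 0 ≤ startTime ℓ
  startTime_lt_endTime : ∀ ℓ, startTime ℓ < endTime ℓ
  endTime_le : ∀ ℓ, endTime ℓ ≤ T
  disjoint : ∀ ℓ ℓ', ℓ ≠ ℓ' → ¬ Disjoint (qubits ℓ) (qubits ℓ') →
    Disjoint (Set.Ico (startTime ℓ) (endTime ℓ)) (Set.Ico (startTime ℓ') (endTime ℓ'))
  gate : Loc → ℝ → Matrix (Bits Q) (Bits Q) ℂ
  gate_hermitian : ∀ ℓ t, (gate ℓ t).IsHermitian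
  gate_local : ∀ ℓ t, ∃ a : Bits (qubits ℓ) → Bits (qubits ℓ) → ℂ,
    gate ℓ t = extendBlocks (qubits ℓ) a
  gate_integrable : ∀ ℓ x y, LocallyIntegrable (fun t => gate ℓ t x y)

/-- The ideal system Hamiltonian `H_S(t)`: the sum of the Hamiltonians of the operations in
progress at time `t`. -/
def Circuit.hamiltonian {Q Loc : Type*} [Fintype Q] [DecidableEq Q] [Fintype Loc]
    (C : Circuit Q Loc) (t : ℝ) : Matrix (Bits Q) (Bits Q) ℂ :=
  ∑ ℓ, Set.indicator (Set.Ico (C.startTime ℓ) (C.endTime ℓ)) (C.gate ℓ) t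

/-- The maximal duration `t₀` of a location. -/
def Circuit.maxDuration {Q Loc : Type*} [Fintype Q] [DecidableEq Q] (C : Circuit Q Loc) : ℝ :=
  ⨆ ℓ, (C.endTime ℓ - C.startTime ℓ)

/-- `U t` is the unitary evolution operator from time `0` to time `t` of the finite-dimensional
system with Hamiltonian `H`: `i dU/dt = H U`, `U 0 = 1`, in integrated form. -/
structure IsSystemEvolution {Q : Type*} [Fintype Q] [DecidableEq Q]
    (H U : ℝ → Matrix (Bits Q) (Bits Q) ℂ) : Prop where
  unitary : ∀ t, U t ∈ Matrix.unitaryGroup (Bits Q) ℂ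
  continuous : Continuous U
  schrodinger : ∀ t x y,
    U t x y = (1 : Matrix (Bits Q) (Bits Q) ℂ) x y -
      Complex.I * ∫ τ in (0 : ℝ)..t, (H τ * U τ) x y

/-- `V t` is the (strongly continuous) unitary evolution operator from time `0` to time `t` of
the bath with possibly unbounded Hamiltonian `H`: the Schrödinger equation holds weakly, i.e. tested
against vectors `φ` in the domain of `H`.  For a time-independent self-adjoint `H` this says
`V t = exp(-i t H)`. -/
structure IsBathEvolution {𝓑 : Type*} [NormedAddCommGroup 𝓑] [InnerProductSpace ℂ 𝓑]
    [CompleteSpace 𝓑] (H : ℝ → 𝓑 →ₗ.[ℂ] 𝓑) (V : ℝ → 𝓑 →L[ℂ] 𝓑) : Prop where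
  unitary : ∀ t, V t ∈ unitary (𝓑 →L[ℂ] 𝓑)
  continuous : ∀ ψ, Continuous (fun t => V t ψ)
  zero : V 0 = 1
  schrodinger : ∀ (φ : 𝓑) (hφ : ∀ τ, φ ∈ (H τ).domain),
    LocallyIntegrable (fun τ => H τ ⟨φ, hφ τ⟩) → ∀ (ψ : 𝓑) (t : ℝ),
      ⟪φ, V t ψ⟫_ℂ = ⟪φ, ψ⟫_ℂ - Complex.I * ∫ τ in (0 : ℝ)..t, ⟪H τ ⟨φ, hφ τ⟩, V τ ψ⟫_ℂ

/-- A noisy quantum computation: an ideal circuit, a bath Hamiltonian `H_B` (arbitrary, possibly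
unbounded and time dependent), and the system-bath coupling
`H_SB(t) = ∑_{S ≠ ∅} coupling S t`, where the term labelled by the set `S` of qubits acts on these
qubits and arbitrarily on the bath. -/
structure NoisyComputation (Q Loc 𝓑 : Type*) [Fintype Q] [DecidableEq Q]
    [NormedAddCommGroup 𝓑] [InnerProductSpace ℂ 𝓑] [CompleteSpace 𝓑] extends Circuit Q Loc where
  bath : ℝ → 𝓑 →ₗ.[ℂ] 𝓑
  bath_selfAdjoint : ∀ t, IsSelfAdjoint (bath t)
  coupling : Finset Q → ℝ → (Joint Q 𝓑 →L[ℂ] Joint Q 𝓑)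
  coupling_selfAdjoint : ∀ S t, IsSelfAdjoint (coupling S t)
  coupling_local : ∀ (S : Finset Q) (t : ℝ), ∃ a : Bits S → Bits S → (𝓑 →L[ℂ] 𝓑),
    coupling S t = ofBlocks (extendBlocks S a)
  coupling_measurable : ∀ S ψ, StronglyMeasurable (fun t => coupling S t ψ)

section

variable {Q Loc 𝓑 : Type*} [Fintype Q] [DecidableEq Q]
  [NormedAddCommGroup 𝓑] [InnerProductSpace ℂ 𝓑] [CompleteSpace 𝓑]

/-- The term `H^{(k)}_{i₁, …, i_k}(t)` of the coupling: it is invariant under permutations of the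
indices and vanishes if two of them coincide. -/
def NoisyComputation.tupleCoupling (M : NoisyComputation Q Loc 𝓑) (k : ℕ) (i : Fin k → Q)
    (t : ℝ) : Joint Q 𝓑 →L[ℂ] Joint Q 𝓑 :=
  if Function.Injective i then M.coupling (Finset.univ.image i) t else 0

/-- The strength of the `k`-qubit terms,
`max_{i₁, t} ∑_{i₂, …, i_k} ‖H^{(k)}_{i₁, …, i_k}(t)‖ t₀`, for `k ≥ 1`. -/
def NoisyComputation.strength (M : NoisyComputation Q Loc 𝓑) : ℕ → ℝ≥0∞
  | 0 => 0
  | k + 1 => ⨆ (i₁ : Q) (t : Set.Icc (0 : ℝ) M.T),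
      ∑ j : Fin k → Q, ‖M.tupleCoupling (k + 1) (Fin.cons i₁ j) t‖ₑ * ENNReal.ofReal M.maxDuration

/-- The unperturbed evolution operator `U_S(t) ⊗ V_B(t)` generated by `H_S + H_B`. -/
def freeEvolution (U : ℝ → Matrix (Bits Q) (Bits Q) ℂ) (V : ℝ → 𝓑 →L[ℂ] 𝓑) (t : ℝ) :
    Joint Q 𝓑 →L[ℂ] Joint Q 𝓑 :=
  ofBlocks (fun x y => U t x y • V t)

/-- The coupling term `S` in the interaction picture defined by the free evolution `W`. -/
def NoisyComputation.interaction (M : NoisyComputation Q Loc 𝓑)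
    (W : ℝ → Joint Q 𝓑 →L[ℂ] Joint Q 𝓑) (S : Finset Q) (t : ℝ) : Joint Q 𝓑 →L[ℂ] Joint Q 𝓑 :=
  ContinuousLinearMap.adjoint (W t) ∘L M.coupling S t ∘L W t

/-- The contribution to the evolution operator over `[0, T]` in which the coupling terms
`S 0, …, S (n-1)` are inserted at the times `t 0 ≥ … ≥ t (n-1)`. -/
def NoisyComputation.insertions (M : NoisyComputation Q Loc 𝓑)
    (W : ℝ → Joint Q 𝓑 →L[ℂ] Joint Q 𝓑) {n : ℕ} (S : Fin n → {S : Finset Q // S.Nonempty})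
    (t : Fin n → ℝ) : Joint Q 𝓑 →L[ℂ] Joint Q 𝓑 :=
  W M.T * (List.ofFn (fun j => (-Complex.I) • M.interaction W (S j) (t j))).prod

/-- Time-ordered insertion times in `[0, T]`, the latest first. -/
def Circuit.orderedTimes (C : Circuit Q Loc) (n : ℕ) : Set (Fin n → ℝ) :=
  {t | Antitone t ∧ ∀ j, t j ∈ Set.Icc 0 C.T}

/-- The location `ℓ` is faulty: at least one of its qubits is struck at least once, by one of the
terms `S j` inserted at the times `t j`, while the operation at `ℓ` is executed. -/
def Circuit.IsFaulty (C : Circuit Q Loc) {n : ℕ} (S : Fin n → {S : Finset Q // S.Nonempty})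
    (t : Fin n → ℝ) (ℓ : Loc) : Prop :=
  ∃ j, t j ∈ Set.Ico (C.startTime ℓ) (C.endTime ℓ) ∧ ∃ q ∈ C.qubits ℓ, q ∈ (S j).1

/-- The region of insertion times of the terms `S 0, …, S (n-1)` for which every location in `I`
is faulty. -/
def Circuit.faultyTimes (C : Circuit Q Loc) (I : Finset Loc) {n : ℕ}
    (S : Fin n → {S : Finset Q // S.Nonempty}) : Set (Fin n → ℝ) :=
  {t | t ∈ C.orderedTimes n ∧ ∀ ℓ ∈ I, C.IsFaulty S t ℓ}

/-- `E = E(I)` is the sum, over all orders `n`, of all the terms in the expansion of the evolution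
operator in powers of the coupling such that every location in `I` is faulty.  The integrals and the
series converge in the strong sense. -/
structure NoisyComputation.IsFaultSum (M : NoisyComputation Q Loc 𝓑)
    (W : ℝ → Joint Q 𝓑 →L[ℂ] Joint Q 𝓑) (I : Finset Loc)
    (E : Joint Q 𝓑 →L[ℂ] Joint Q 𝓑) : Prop where
  integrable : ∀ (n : ℕ) (S : Fin n → {S : Finset Q // S.Nonempty}) (ψ : Joint Q 𝓑),
    IntegrableOn (fun t => M.insertions W S t ψ) (M.faultyTimes I S)
  hasSum : ∀ ψ : Joint Q 𝓑, HasSum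
    (fun n : ℕ => ∑ S : Fin n → {S : Finset Q // S.Nonempty},
      ∫ t in M.faultyTimes I S, M.insertions W S t ψ) (E ψ)

/-- The noise has effective noise strength `ε`: `‖E(I)‖ ≤ ε ^ r` for every set `I` of `r`
locations (in particular the expansion defining `E(I)` converges). -/
def NoisyComputation.HasEffectiveNoiseStrength (M : NoisyComputation Q Loc 𝓑)
    (W : ℝ → Joint Q 𝓑 →L[ℂ] Joint Q 𝓑) (ε : ℝ) : Prop :=
  ∀ I : Finset Loc, ∃ E : Joint Q 𝓑 →L[ℂ] Joint Q 𝓑, M.IsFaultSum W I E ∧ ‖E‖ ≤ ε ^ I.card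

end

/-- The `l`-th term `(k-1)! f_{k+l} (2α)^l / (k+l-1)!` of the series `g_k`, for `k ≥ 1`. -/
def gTerm (f : ℕ → ℝ) (α : ℝ) (k l : ℕ) : ℝ :=
  ((k - 1).factorial : ℝ) * f (k + l) * (2 * α) ^ l / ((k + l - 1).factorial : ℝ)

/-- `g_k = ∑_{l ≥ 0} (k-1)! f_{k+l} (2α)^l / (k+l-1)!`, for `k ≥ 1`. -/
def g (f : ℕ → ℝ) (α : ℝ) (k : ℕ) : ℝ := ∑' l : ℕ, gTerm f α k l

end CorrelatedNoise

end

/-!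
In the interaction picture the evolution solves `u' = ∑ A_S u`, with skew-adjoint generators `A_S`.
Split `u = ∑ u_J` according to the set `J` of locations of `I` made faulty so far: if `A_S` strikes
the locations `m(S)`, then the derivative of `u_J` is the sum of `A_S u_K` over all `S` and `K` with
`K ∪ m(S) = J`, and `E(I)` is the component `J = I` at the final time. The terms with `K = J` are
skew and do not change `‖u_J‖`; the others only involve smaller sets. By induction on `J`,
`‖u_J‖ ≤ c ^ |J| * exp (∫ γ)` as soon as `γ ≥ ∑ ‖A_S‖ ∑ c ^ (-|B|)`, the inner sum being over the
non-empty `B ⊆ m(S)`.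

Since simultaneous locations have disjoint qubits, a term on `k` qubits strikes at most `k` of them.
Counting the terms that strike a given location bounds that sum, for `c > 2 m α`, by the number of
active locations times `κ / t₀`, where `κ = ∑ g_k / (2 k!)`. Hence `∫ γ ≤ |I| κ`, and `c → 2 m α`.
-/

noncomputable section

namespace CorrelatedNoise

section AbsolutelyContinuous

lemma absolutelyContinuousOnInterval_of_dist_le {X Y : Type*} [PseudoMetricSpace X]
    [PseudoMetricSpace Y] {f : ℝ → X} {g : ℝ → Y} {a b : ℝ}
    (hg : AbsolutelyContinuousOnInterval g a b)
    (h : ∀ x ∈ Set.uIcc a b, ∀ y ∈ Set.uIcc a b, dist (f x) (f y) ≤ dist (g x) (g y)) :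
    AbsolutelyContinuousOnInterval f a b := by
  rw [absolutelyContinuousOnInterval_iff] at hg ⊢
  intro ε hε
  obtain ⟨δ, hδ, hE⟩ := hg ε hε
  refine ⟨δ, hδ, fun E hmem hlt => (Finset.sum_le_sum fun i hi => ?_).trans_lt (hE E hmem hlt)⟩
  obtain ⟨hx, hy⟩ := hmem.1 i hi
  exact h _ hx _ hy

lemma integral_mul_exp_integral {γ : ℝ → ℝ} {a b : ℝ} (hγ : IntervalIntegrable γ volume a b) :
    ∫ s in a..b, γ s * Real.exp (∫ τ in a..s, γ τ) = Real.exp (∫ s in a..b, γ s) - 1 := by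
  set Γ : ℝ → ℝ := fun t => ∫ τ in a..t, γ τ with hΓ
  have hΓac : AbsolutelyContinuousOnInterval Γ a b :=
    hγ.absolutelyContinuousOnInterval_intervalIntegral Set.left_mem_uIcc
  obtain ⟨C, hC⟩ := hΓac.exists_bound
  have hexp : LipschitzOnWith (Real.exp C).toNNReal Real.exp (Set.Iic C) :=
    (convex_Iic C).lipschitzOnWith_of_nnnorm_deriv_le
      (fun x _ => Real.differentiableAt_exp) fun x hx => by
        rw [← NNReal.coe_le_coe]
        simpa [(Real.exp_pos _).le] using hx
  have hac : AbsolutelyContinuousOnInterval (fun t => Real.exp (Γ t)) a b := by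
    refine absolutelyContinuousOnInterval_of_dist_le (hΓac.const_mul (Real.exp C))
      fun x hx y hy => ?_
    have := hexp.dist_le_mul _ ((le_abs_self _).trans (hC x hx)) _
      ((le_abs_self _).trans (hC y hy))
    rw [Real.coe_toNNReal _ (Real.exp_pos C).le] at this
    rwa [Real.dist_eq (Real.exp C * _), ← mul_sub, abs_mul, abs_of_pos (Real.exp_pos C),
      ← Real.dist_eq]
  rw [show Real.exp (∫ s in a..b, γ s) - 1 = Real.exp (Γ b) - Real.exp (Γ a) by simp [hΓ],
    ← hac.integral_deriv_eq_sub]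
  refine intervalIntegral.integral_congr_ae ?_
  filter_upwards [hγ.ae_hasDerivAt_integral] with t ht htmem
  rw [((ht (Set.uIoc_subset_uIcc htmem) a Set.left_mem_uIcc).exp).deriv, mul_comm]

lemma intervalIntegrable_mul_exp_integral {γ : ℝ → ℝ} {a b : ℝ}
    (hγ : IntervalIntegrable γ volume a b) :
    IntervalIntegrable (fun s => γ s * Real.exp (∫ τ in a..s, γ τ)) volume a b :=
  hγ.mul_continuousOn (hγ.absolutelyContinuousOnInterval_intervalIntegral
    Set.left_mem_uIcc).continuousOn.rexp

end AbsolutelyContinuous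

section NormPrimitive

variable {E : Type*} [NormedAddCommGroup E] [InnerProductSpace ℝ E]

lemma norm_mul_deriv_norm {y : ℝ → E} {y' : E} {t : ℝ} (hy : HasDerivAt y y' t)
    (hn : DifferentiableAt ℝ (fun s => ‖y s‖) t) :
    ‖y t‖ * deriv (fun s => ‖y s‖) t = ⟪y t, y'⟫_ℝ := by
  have := (hn.hasDerivAt.pow 2).unique hy.norm_sq
  simp only [Nat.cast_ofNat, Nat.add_one_sub_one, pow_one] at this
  linarith

lemma deriv_norm_le_of_inner_le {y : ℝ → E} {y' : E} {t w : ℝ} (hy : HasDerivAt y y' t)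
    (hn : DifferentiableAt ℝ (fun s => ‖y s‖) t) (hw : 0 ≤ w) (h : ⟪y t, y'⟫_ℝ ≤ ‖y t‖ * w) :
    deriv (fun s => ‖y s‖) t ≤ w := by
  rcases eq_or_ne (y t) 0 with hyt | hyt
  · have hmin : IsLocalMin (fun s => ‖y s‖) t :=
      Filter.Eventually.of_forall fun s => by simp [hyt]
    rwa [hmin.deriv_eq_zero]
  · rw [← norm_mul_deriv_norm hy hn] at h
    exact le_of_mul_le_mul_left h (norm_pos_iff.2 hyt)

lemma absolutelyContinuousOnInterval_norm_add_integral {v : ℝ → E} {a b : ℝ} (u₀ : E)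
    (hv : IntervalIntegrable v volume a b) :
    AbsolutelyContinuousOnInterval (fun t => ‖u₀ + ∫ s in a..t, v s‖) a b := by
  have hsub : ∀ t ∈ Set.uIcc a b, IntervalIntegrable v volume a t := fun t ht =>
    hv.mono_set (Set.uIcc_subset_uIcc_left ht)
  refine absolutelyContinuousOnInterval_of_dist_le
    (hv.norm.absolutelyContinuousOnInterval_intervalIntegral Set.left_mem_uIcc)
    fun x hx y hy => ?_
  calc dist ‖u₀ + ∫ s in a..x, v s‖ ‖u₀ + ∫ s in a..y, v s‖
      ≤ ‖(∫ s in a..x, v s) - ∫ s in a..y, v s‖ := by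
        simpa only [Real.dist_eq, add_sub_add_left_eq_sub] using abs_norm_sub_norm_le
          (u₀ + ∫ s in a..x, v s) (u₀ + ∫ s in a..y, v s)
    _ = ‖∫ s in y..x, v s‖ := by
        rw [intervalIntegral.integral_interval_sub_left (hsub x hx) (hsub y hy)]
    _ ≤ |∫ s in y..x, ‖v s‖| := intervalIntegral.norm_integral_le_abs_integral_norm
    _ = dist (∫ s in a..x, ‖v s‖) (∫ s in a..y, ‖v s‖) := by
        rw [Real.dist_eq,
          intervalIntegral.integral_interval_sub_left (hsub x hx).norm (hsub y hy).norm]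

lemma norm_add_integral_le [CompleteSpace E] {u v : ℝ → E} {w : ℝ → ℝ} {a b : ℝ} {u₀ : E}
    (hab : a ≤ b) (hv : IntervalIntegrable v volume a b) (hw : IntervalIntegrable w volume a b)
    (hu : ∀ t ∈ Set.Icc a b, u t = u₀ + ∫ s in a..t, v s) (hw₀ : ∀ s ∈ Set.Icc a b, 0 ≤ w s)
    (h : ∀ s ∈ Set.Icc a b, ⟪u s, v s⟫_ℝ ≤ ‖u s‖ * w s) :
    ‖u b‖ ≤ ‖u₀‖ + ∫ s in a..b, w s := by
  have hac := absolutelyContinuousOnInterval_norm_add_integral u₀ hv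
  rw [hu b ⟨hab, le_rfl⟩, ← sub_le_iff_le_add']
  calc ‖u₀ + ∫ s in a..b, v s‖ - ‖u₀‖
      = ∫ t in a..b, deriv (fun t => ‖u₀ + ∫ s in a..t, v s‖) t := by
        simp [hac.integral_deriv_eq_sub]
    _ ≤ ∫ s in a..b, w s := by
        refine intervalIntegral.integral_mono_ae_restrict hab hac.intervalIntegrable_deriv hw ?_
        rw [Filter.EventuallyLE, ae_restrict_iff' measurableSet_Icc]
        filter_upwards [hv.ae_hasDerivAt_integral, hac.ae_differentiableAt] with t hder hdiff ht
        have ht' : t ∈ Set.uIcc a b := by rwa [Set.uIcc_of_le hab]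
        refine deriv_norm_le_of_inner_le ((hder ht' a Set.left_mem_uIcc).const_add u₀) (hdiff ht')
          (hw₀ t ht) ?_
        simpa only [hu t ht] using h t ht

end NormPrimitive

section StrongMeasurability

variable {α E F : Type*} [MeasurableSpace α]
  [NormedAddCommGroup E] [NormedSpace ℂ E] [NormedAddCommGroup F] [NormedSpace ℂ F]

lemma stronglyMeasurable_clm_apply {A : α → E →L[ℂ] F}
    (hA : ∀ x, StronglyMeasurable fun a => A a x) {φ : α → E} (hφ : StronglyMeasurable φ) :
    StronglyMeasurable fun a => A a (φ a) := by
  have happrox : ∀ n, StronglyMeasurable fun a => A a (hφ.approx n a) := by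
    intro n
    have h : (fun a => A a (hφ.approx n a)) = fun a =>
        ∑ y ∈ (hφ.approx n).range, (hφ.approx n ⁻¹' {y}).indicator (fun a => A a y) a := by
      funext a
      rw [Finset.sum_eq_single (hφ.approx n a)]
      · simp
      · intro y _ hy
        simp [Set.indicator, hy.symm]
      · intro h
        simp at h
    rw [h]
    exact Finset.stronglyMeasurable_fun_sum _ fun y _ =>
      (hA y).indicator ((hφ.approx n).measurableSet_preimage _)
  exact stronglyMeasurable_of_tendsto Filter.atTop happrox
    (tendsto_pi_nhds.2 fun a => ((A a).continuous.tendsto _).comp (hφ.tendsto_approx a))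

end StrongMeasurability

section Dyson

variable {E : Type*} [NormedAddCommGroup E] [NormedSpace ℂ E]

/-- `G` is a strongly measurable family of operators bounded by `C`: the generator of an evolution
equation `u' = G u` that is solved by its perturbation series. -/
structure IsBoundedGenerator (G : ℝ → E →L[ℂ] E) (C : ℝ) : Prop where
  stronglyMeasurable_apply : ∀ x, StronglyMeasurable fun s => G s x
  norm_le : ∀ s, ‖G s‖ ≤ C

/-- The `n`-th order term `∫ G(s₁) ⋯ G(sₙ) x`, over `t ≥ s₁ ≥ ⋯ ≥ sₙ ≥ 0`, of the perturbation
series for `u' = G u`, `u(0) = x`, as an iterated integral. -/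
def dysonTerm (G : ℝ → E →L[ℂ] E) (x : E) : ℕ → ℝ → E
  | 0, _ => x
  | n + 1, t => ∫ s in (0 : ℝ)..t, G s (dysonTerm G x n s)

/-- The sum of the perturbation series for `u' = G u`, `u(0) = x`. -/
def dysonSeries (G : ℝ → E →L[ℂ] E) (x : E) (t : ℝ) : E := ∑' n, dysonTerm G x n t

namespace IsBoundedGenerator

variable {G : ℝ → E →L[ℂ] E} {C : ℝ}

lemma nonneg (hG : IsBoundedGenerator G C) : 0 ≤ C := (norm_nonneg _).trans (hG.norm_le 0)

lemma sum {ι : Type*} [Fintype ι] {A : ι → ℝ → E →L[ℂ] E} {C : ι → ℝ}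
    (hA : ∀ i, IsBoundedGenerator (A i) (C i)) :
    IsBoundedGenerator (fun s => ∑ i, A i s) (∑ i, C i) where
  stronglyMeasurable_apply x := by
    simp only [sum_apply]
    exact Finset.stronglyMeasurable_fun_sum _ fun i _ => (hA i).stronglyMeasurable_apply x
  norm_le s := norm_sum_le_of_le _ fun i _ => (hA i).norm_le s

lemma norm_apply_le (hG : IsBoundedGenerator G C) (s : ℝ) (x : E) : ‖G s x‖ ≤ C * ‖x‖ :=
  (G s).le_of_opNorm_le (hG.norm_le s) x

lemma intervalIntegrable_apply (hG : IsBoundedGenerator G C) {u : ℝ → E} (hu : Continuous u)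
    (a b : ℝ) : IntervalIntegrable (fun s => G s (u s)) volume a b :=
  ((hu.norm.const_mul C).intervalIntegrable a b).mono_fun
    (stronglyMeasurable_clm_apply hG.stronglyMeasurable_apply
      hu.stronglyMeasurable).aestronglyMeasurable
    (.of_forall fun s => (hG.norm_apply_le s _).trans (le_abs_self _))

lemma continuous_dysonTerm (hG : IsBoundedGenerator G C) (x : E) (n : ℕ) :
    Continuous (dysonTerm G x n) := by
  induction n with
  | zero => exact continuous_const
  | succ n ih => exact intervalIntegral.continuous_primitive (hG.intervalIntegrable_apply ih) 0

lemma norm_dysonTerm_le (hG : IsBoundedGenerator G C) (x : E) (n : ℕ) (t : ℝ) :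
    ‖dysonTerm G x n t‖ ≤ (C * |t|) ^ n / n.factorial * ‖x‖ := by
  induction n generalizing t with
  | zero => simp [dysonTerm]
  | succ n ih =>
    have hbound : ∀ s,
        ‖G s (dysonTerm G x n s)‖ ≤ C ^ (n + 1) / n.factorial * ‖x‖ * |s - 0| ^ n := by
      intro s
      calc ‖G s (dysonTerm G x n s)‖ ≤ C * ((C * |s|) ^ n / n.factorial * ‖x‖) :=
            (hG.norm_apply_le s _).trans (mul_le_mul_of_nonneg_left (ih s) hG.nonneg)
        _ = _ := by rw [sub_zero]; ring
    have hint : IntegrableOn (fun s : ℝ => C ^ (n + 1) / n.factorial * ‖x‖ * |s - 0| ^ n)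
        (Set.uIoc 0 t) :=
      (Continuous.integrableOn_uIcc (by fun_prop)).mono_set Set.uIoc_subset_uIcc
    calc ‖dysonTerm G x (n + 1) t‖ = ‖∫ s in Set.uIoc 0 t, G s (dysonTerm G x n s)‖ :=
          intervalIntegral.norm_integral_eq_norm_integral_uIoc _
      _ ≤ ∫ s in Set.uIoc 0 t, C ^ (n + 1) / n.factorial * ‖x‖ * |s - 0| ^ n :=
          norm_integral_le_of_norm_le hint (.of_forall hbound)
      _ = (C * |t|) ^ (n + 1) / (n + 1).factorial * ‖x‖ := by
          rw [integral_const_mul, integral_pow_abs_sub_uIoc, Nat.factorial_succ]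
          push_cast
          rw [sub_zero, mul_pow]
          field_simp

lemma norm_dysonTerm_le_of_abs_le (hG : IsBoundedGenerator G C) (x : E) (n : ℕ) {s t : ℝ}
    (hst : |s| ≤ t) : ‖dysonTerm G x n s‖ ≤ (C * t) ^ n / n.factorial * ‖x‖ := by
  refine (hG.norm_dysonTerm_le x n s).trans ?_
  have := hG.nonneg
  gcongr

lemma norm_dysonSeries_le (hG : IsBoundedGenerator G C) (x : E) (t : ℝ) :
    ‖dysonSeries G x t‖ ≤ Real.exp (C * |t|) * ‖x‖ := by
  refine tsum_of_norm_bounded (HasSum.mul_right _ ?_) fun n => hG.norm_dysonTerm_le x n t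
  rw [Real.exp_eq_exp_ℝ]
  exact NormedSpace.expSeries_div_hasSum_exp _

lemma dysonTerm_add (hG : IsBoundedGenerator G C) (x y : E) (n : ℕ) (t : ℝ) :
    dysonTerm G (x + y) n t = dysonTerm G x n t + dysonTerm G y n t := by
  induction n generalizing t with
  | zero => rfl
  | succ n ih =>
    simp only [dysonTerm, ih, map_add]
    exact intervalIntegral.integral_add
      (hG.intervalIntegrable_apply (hG.continuous_dysonTerm x n) _ _)
      (hG.intervalIntegrable_apply (hG.continuous_dysonTerm y n) _ _)

end IsBoundedGenerator

lemma dysonTerm_smul (G : ℝ → E →L[ℂ] E) (a : ℂ) (x : E) (n : ℕ) (t : ℝ) :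
    dysonTerm G (a • x) n t = a • dysonTerm G x n t := by
  induction n generalizing t with
  | zero => rfl
  | succ n ih => simp only [dysonTerm, ih, map_smul, intervalIntegral.integral_smul]

lemma dysonSeries_smul (G : ℝ → E →L[ℂ] E) (a : ℂ) (x : E) (t : ℝ) :
    dysonSeries G (a • x) t = a • dysonSeries G x t := by
  simp only [dysonSeries, dysonTerm_smul, tsum_const_smul'']

namespace IsBoundedGenerator

variable {G : ℝ → E →L[ℂ] E} {C : ℝ} [CompleteSpace E]

lemma hasSum_dysonTerm (hG : IsBoundedGenerator G C) (x : E) (t : ℝ) :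
    HasSum (fun n => dysonTerm G x n t) (dysonSeries G x t) :=
  (((Real.summable_pow_div_factorial _).mul_right _).of_norm_bounded
    fun n => hG.norm_dysonTerm_le x n t).hasSum

lemma dysonSeries_add (hG : IsBoundedGenerator G C) (x y : E) (t : ℝ) :
    dysonSeries G (x + y) t = dysonSeries G x t + dysonSeries G y t := by
  refine (hG.hasSum_dysonTerm (x + y) t).unique ?_
  simpa only [hG.dysonTerm_add] using (hG.hasSum_dysonTerm x t).add (hG.hasSum_dysonTerm y t)

lemma continuous_dysonSeries (hG : IsBoundedGenerator G C) (x : E) :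
    Continuous (dysonSeries G x) := by
  refine continuous_iff_continuousAt.2 fun t => ?_
  have hon : ContinuousOn (dysonSeries G x) (Metric.closedBall 0 (|t| + 1)) :=
    continuousOn_tsum (fun n => (hG.continuous_dysonTerm x n).continuousOn)
      ((Real.summable_pow_div_factorial (C * (|t| + 1))).mul_right _)
      fun n s hs => hG.norm_dysonTerm_le_of_abs_le x n (by simpa using hs)
  exact hon.continuousAt (Metric.closedBall_mem_nhds_of_mem (by simp))

lemma dysonSeries_eq_add_integral (hG : IsBoundedGenerator G C) (x : E) (t : ℝ) :
    dysonSeries G x t = x + ∫ s in (0 : ℝ)..t, G s (dysonSeries G x s) := by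
  have htail : HasSum (fun n => dysonTerm G x (n + 1) t)
      (∫ s in (0 : ℝ)..t, G s (dysonSeries G x s)) := by
    refine intervalIntegral.hasSum_integral_of_dominated_convergence
      (fun n _ => C * ((C * |t|) ^ n / n.factorial * ‖x‖))
      (fun n => (stronglyMeasurable_clm_apply hG.stronglyMeasurable_apply
        (hG.continuous_dysonTerm x n).stronglyMeasurable).aestronglyMeasurable)
      (fun n => .of_forall fun s hs => ?_)
      (.of_forall fun s _ => ((Real.summable_pow_div_factorial _).mul_right _).mul_left _)
      intervalIntegrable_const (.of_forall fun s _ => (G s).hasSum (hG.hasSum_dysonTerm x s))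
    have hst : |s| ≤ |t| := by
      simpa using Set.abs_sub_left_of_mem_uIcc (Set.uIoc_subset_uIcc hs)
    exact (hG.norm_apply_le s _).trans
      (mul_le_mul_of_nonneg_left (hG.norm_dysonTerm_le_of_abs_le x n hst) hG.nonneg)
  refine (hG.hasSum_dysonTerm x t).unique ?_
  have := (hasSum_nat_add_iff (f := fun n => dysonTerm G x n t) 1).1 htail
  simpa only [Finset.sum_range_one, dysonTerm, add_comm] using this

lemma intervalIntegrable_map_apply_dysonSeries {F : Type*} [NormedAddCommGroup F]
    [NormedSpace ℂ F] (hG : IsBoundedGenerator G C) (P : E →L[ℂ] F) (x : E) (a b : ℝ) :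
    IntervalIntegrable (fun s => P (G s (dysonSeries G x s))) volume a b :=
  have hint := hG.intervalIntegrable_apply (hG.continuous_dysonSeries x) a b
  ⟨P.integrable_comp hint.1, P.integrable_comp hint.2⟩

lemma map_dysonSeries_eq_add_integral {F : Type*} [NormedAddCommGroup F] [NormedSpace ℂ F]
    [CompleteSpace F] (hG : IsBoundedGenerator G C) (P : E →L[ℂ] F) (x : E) (t : ℝ) :
    P (dysonSeries G x t) = P x + ∫ s in (0 : ℝ)..t, P (G s (dysonSeries G x s)) := by
  rw [P.intervalIntegral_comp_comm
    (hG.intervalIntegrable_apply (hG.continuous_dysonSeries x) 0 t), ← map_add,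
    ← hG.dysonSeries_eq_add_integral]

/-- The evolution operator from time `0` to time `t` of the equation `u' = G u`. -/
def evolutionOperator (hG : IsBoundedGenerator G C) (t : ℝ) : E →L[ℂ] E :=
  LinearMap.mkContinuous
    { toFun := fun x => dysonSeries G x t
      map_add' := fun x y => hG.dysonSeries_add x y t
      map_smul' := fun a x => dysonSeries_smul G a x t }
    (Real.exp (C * |t|)) fun x => hG.norm_dysonSeries_le x t

end IsBoundedGenerator

end Dyson

section TimeOrdered

/-- The tuples of times `t ≥ p 0 ≥ p 1 ≥ ⋯ ≥ 0` over which a term of order `n` is integrated. -/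
def timeSimplex (n : ℕ) (t : ℝ) : Set (Fin n → ℝ) :=
  {p | Antitone p ∧ ∀ j, p j ∈ Set.Icc 0 t}

lemma isClosed_timeSimplex (n : ℕ) (t : ℝ) : IsClosed (timeSimplex n t) := by
  simp only [timeSimplex, Antitone, Set.ofPred_and, Set.ofPred_forall]
  refine .inter ?_ (isClosed_iInter fun j => isClosed_Icc.preimage (continuous_apply j))
  exact isClosed_iInter fun a => isClosed_iInter fun b => isClosed_iInter fun _ =>
    isClosed_le (continuous_apply b) (continuous_apply a)

lemma volume_timeSimplex_lt_top (n : ℕ) (t : ℝ) : volume (timeSimplex n t) < ∞ := by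
  refine (measure_mono (t := Set.Icc (fun _ => 0) (fun _ => t)) fun p hp => ?_).trans_lt
    isCompact_Icc.measure_lt_top
  exact ⟨fun j => (hp.2 j).1, fun j => (hp.2 j).2⟩

lemma cons_mem_timeSimplex {n : ℕ} {t s : ℝ} {p : Fin n → ℝ} :
    (Fin.cons s p : Fin (n + 1) → ℝ) ∈ timeSimplex (n + 1) t ↔
      s ∈ Set.Icc 0 t ∧ p ∈ timeSimplex n s := by
  constructor
  · rintro ⟨hanti, hmem⟩
    refine ⟨by simpa using hmem 0, fun a b hab => ?_, fun j => ⟨by simpa using (hmem j.succ).1, ?_⟩⟩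
    · simpa using hanti (Fin.succ_le_succ_iff.2 hab)
    · simpa using hanti (Fin.zero_le j.succ)
  · rintro ⟨hs, hanti, hmem⟩
    refine ⟨fun a b hab => ?_, Fin.forall_fin_succ.2
      ⟨by simpa using hs, fun j => by simpa using ⟨(hmem j).1, (hmem j).2.trans hs.2⟩⟩⟩
    cases a using Fin.cases <;> cases b using Fin.cases
    · exact le_rfl
    · simpa using (hmem _).2
    · exact absurd hab (by simp)
    · simpa using hanti (Fin.succ_le_succ_iff.1 hab)

lemma integral_pi_fin_succ {E : Type*} [NormedAddCommGroup E] [NormedSpace ℝ E] {n : ℕ}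
    {f : (Fin (n + 1) → ℝ) → E} (hf : Integrable f) :
    ∫ p, f p = ∫ s, ∫ p : Fin n → ℝ, f (Fin.cons s p) := by
  have hmp := (volume_preserving_piFinSuccAbove (fun _ : Fin (n + 1) => ℝ) 0).symm
  have hcons : f ∘ (MeasurableEquiv.piFinSuccAbove (fun _ : Fin (n + 1) => ℝ) 0).symm =
      fun z : ℝ × (Fin n → ℝ) => f (Fin.cons z.1 z.2) := by
    funext z
    simp [MeasurableEquiv.piFinSuccAbove, Fin.insertNthEquiv]
  have hprod : Integrable (fun z : ℝ × (Fin n → ℝ) => f (Fin.cons z.1 z.2))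
      (volume.prod volume) := (hcons ▸ hmp.integrable_comp_of_integrable hf :)
  rw [← integral_prod _ hprod, ← hmp.integral_comp (MeasurableEquiv.measurableEmbedding _),
    ← hcons]
  rfl

lemma setIntegral_timeSimplex_succ {E : Type*} [NormedAddCommGroup E] [NormedSpace ℝ E]
    {n : ℕ} {t : ℝ} {f : (Fin (n + 1) → ℝ) → E} (hf : IntegrableOn f (timeSimplex (n + 1) t)) :
    ∫ p in timeSimplex (n + 1) t, f p =
      ∫ s in Set.Icc 0 t, ∫ p in timeSimplex n s, f (Fin.cons s p) := by
  have hmeas : ∀ m s, MeasurableSet (timeSimplex m s) := fun m s =>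
    (isClosed_timeSimplex m s).measurableSet
  rw [← integral_indicator (hmeas _ t), integral_pi_fin_succ (hf.integrable_indicator (hmeas _ t)),
    ← integral_indicator measurableSet_Icc]
  refine integral_congr_ae (.of_forall fun s => ?_)
  by_cases hs : s ∈ Set.Icc 0 t
  · simp only [Set.indicator_of_mem hs]
    rw [← integral_indicator (hmeas n s)]
    refine integral_congr_ae (.of_forall fun p => ?_)
    by_cases hp : p ∈ timeSimplex n s
    · simp only [Set.indicator_of_mem hp]
      exact Set.indicator_of_mem (cons_mem_timeSimplex.2 ⟨hs, hp⟩) f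
    · simp only [Set.indicator_of_notMem hp]
      exact Set.indicator_of_notMem (fun h => hp (cons_mem_timeSimplex.1 h).2) f
  · simp only [Set.indicator_of_notMem hs]
    exact integral_eq_zero_of_ae (.of_forall fun p =>
      Set.indicator_of_notMem (fun h => hs (cons_mem_timeSimplex.1 h).1) f)

variable {E : Type*} [NormedAddCommGroup E] [NormedSpace ℂ E]

/-- The product `A₀(p₀) ⋯ Aₙ₋₁(pₙ₋₁)` of the operators `A` at the times `p`. -/
def timeOrderedProd {n : ℕ} (A : Fin n → ℝ → E →L[ℂ] E) (p : Fin n → ℝ) : E →L[ℂ] E :=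
  (List.ofFn fun j => A j (p j)).prod

lemma timeOrderedProd_cons {n : ℕ} (A : Fin (n + 1) → ℝ → E →L[ℂ] E) (s : ℝ) (p : Fin n → ℝ) :
    timeOrderedProd A (Fin.cons s p) = A 0 s * timeOrderedProd (Fin.tail A) p := by
  simp [timeOrderedProd, List.ofFn_succ, Fin.tail]

lemma stronglyMeasurable_timeOrderedProd_apply {n : ℕ} {A : Fin n → ℝ → E →L[ℂ] E}
    (hA : ∀ j x, StronglyMeasurable fun s => A j s x) (x : E) :
    StronglyMeasurable fun p => timeOrderedProd A p x := by
  induction n with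
  | zero => simp [timeOrderedProd]
  | succ n ih =>
    have hcons : (fun p => timeOrderedProd A p x) = fun p =>
        A 0 (p 0) (timeOrderedProd (Fin.tail A) (Fin.tail p) x) := by
      funext p
      conv_lhs => rw [← Fin.cons_self_tail p, timeOrderedProd_cons]
      rfl
    rw [hcons]
    exact stronglyMeasurable_clm_apply
      (fun y => (hA 0 y).comp_measurable (measurable_pi_apply 0))
      ((ih fun j => hA j.succ).comp_measurable
        (measurable_pi_lambda _ fun j => measurable_pi_apply j.succ))

lemma norm_timeOrderedProd_le {n : ℕ} {A : Fin n → ℝ → E →L[ℂ] E} {C : Fin n → ℝ}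
    (hA : ∀ j s, ‖A j s‖ ≤ C j) (p : Fin n → ℝ) : ‖timeOrderedProd A p‖ ≤ ∏ j, C j := by
  induction n with
  | zero =>
    simp only [timeOrderedProd, List.ofFn_zero, List.prod_nil, Finset.univ_eq_empty,
      Finset.prod_empty]
    exact ContinuousLinearMap.norm_id_le
  | succ n ih =>
    rw [← Fin.cons_self_tail p, timeOrderedProd_cons, Fin.prod_univ_succ]
    exact (norm_mul_le _ _).trans (mul_le_mul (hA 0 _) (ih (fun j => hA j.succ) _) (norm_nonneg _)
      ((norm_nonneg _).trans (hA 0 0)))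

lemma integrableOn_timeOrderedProd_apply {n : ℕ} {A : Fin n → ℝ → E →L[ℂ] E} {C : Fin n → ℝ}
    (hA : ∀ j, IsBoundedGenerator (A j) (C j)) (x : E) (t : ℝ) :
    IntegrableOn (fun p => timeOrderedProd A p x) (timeSimplex n t) :=
  Measure.integrableOn_of_bounded (volume_timeSimplex_lt_top n t).ne
    (stronglyMeasurable_timeOrderedProd_apply
      (fun j => (hA j).stronglyMeasurable_apply) x).aestronglyMeasurable
    (.of_forall fun p => (timeOrderedProd A p).le_of_opNorm_le
      (norm_timeOrderedProd_le (fun j => (hA j).norm_le) p) x)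

lemma IsBoundedGenerator.dysonTerm_eq_setIntegral [CompleteSpace E] {G : ℝ → E →L[ℂ] E} {C : ℝ}
    (hG : IsBoundedGenerator G C) (x : E) (n : ℕ) {t : ℝ} (ht : 0 ≤ t) :
    dysonTerm G x n t = ∫ p in timeSimplex n t, timeOrderedProd (fun _ => G) p x := by
  induction n generalizing t with
  | zero =>
    have huniv : timeSimplex 0 t = Set.univ :=
      Set.eq_univ_of_forall fun p => ⟨fun a => a.elim0, fun j => j.elim0⟩
    simp [huniv, dysonTerm, timeOrderedProd, volume_pi, Measure.real]
  | succ n ih =>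
    rw [dysonTerm, setIntegral_timeSimplex_succ
        (integrableOn_timeOrderedProd_apply (fun _ => hG) x t),
      intervalIntegral.integral_of_le ht, ← integral_Icc_eq_integral_Ioc]
    refine setIntegral_congr_fun measurableSet_Icc fun s hs => ?_
    simp only [timeOrderedProd_cons, mul_apply_eq_comp, ih hs.1]
    exact ((G s).integral_comp_comm
      (integrableOn_timeOrderedProd_apply (fun _ => hG) x s)).symm

lemma prod_ofFn_sum {R ι : Type*} [Semiring R] [Fintype ι] {n : ℕ} (a : Fin n → ι → R) :
    (List.ofFn fun j => ∑ i, a j i).prod =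
      ∑ S : Fin n → ι, (List.ofFn fun j => a j (S j)).prod := by
  induction n with
  | zero => simp
  | succ n ih =>
    rw [← (Fin.consEquiv fun _ : Fin (n + 1) => ι).sum_comp, Fintype.sum_prod_type]
    simp [List.ofFn_succ, ih, Finset.sum_mul_sum, Fin.consEquiv]

lemma dysonTerm_sum_eq_sum_setIntegral [CompleteSpace E] {ι : Type*} [Fintype ι]
    {A : ι → ℝ → E →L[ℂ] E} {C : ι → ℝ} (hA : ∀ i, IsBoundedGenerator (A i) (C i)) (x : E) (n : ℕ)
    {t : ℝ} (ht : 0 ≤ t) :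
    dysonTerm (fun s => ∑ i, A i s) x n t =
      ∑ S : Fin n → ι, ∫ p in timeSimplex n t, timeOrderedProd (fun j => A (S j)) p x := by
  have hexpand : ∀ p : Fin n → ℝ, timeOrderedProd (fun _ s => ∑ i, A i s) p x =
      ∑ S : Fin n → ι, timeOrderedProd (fun j => A (S j)) p x := fun p => by
    simp only [timeOrderedProd, prod_ofFn_sum, sum_apply]
  simp only [(IsBoundedGenerator.sum hA).dysonTerm_eq_setIntegral x n ht, hexpand]
  exact integral_finsetSum _ fun S _ => integrableOn_timeOrderedProd_apply (fun j => hA (S j)) x t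

end TimeOrdered

section Labelled

lemma stronglyMeasurable_pi {α ι E : Type*} [MeasurableSpace α] [Finite ι]
    [NormedAddCommGroup E] {f : α → ι → E} (hf : ∀ i, StronglyMeasurable fun a => f a i) :
    StronglyMeasurable f := by
  classical
  cases nonempty_fintype ι
  have hsum : f = fun a => ∑ i, Pi.single i (f a i) :=
    funext fun a => (Finset.univ_sum_single (f a)).symm
  rw [hsum]
  exact Finset.stronglyMeasurable_fun_sum _ fun i _ =>
    (continuous_single (A := fun _ => E) i).comp_stronglyMeasurable (hf i)

lemma measurableSet_finset_eq {α L : Type*} [MeasurableSpace α] [Finite L] {m : α → Finset L}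
    (hm : ∀ ℓ, MeasurableSet {a | ℓ ∈ m a}) (J : Finset L) : MeasurableSet {a | m a = J} := by
  classical
  have hinter : {a | m a = J} = ⋂ ℓ, {a | ℓ ∈ m a ↔ ℓ ∈ J} := by
    ext a
    simp [Finset.ext_iff]
  rw [hinter]
  refine MeasurableSet.iInter fun ℓ => ?_
  by_cases hℓ : ℓ ∈ J
  · simpa only [hℓ, iff_true] using hm ℓ
  · simp only [hℓ, iff_false]
    exact (hm ℓ).compl

variable {L : Type*} [Fintype L] [DecidableEq L]

section Operator

variable {E : Type*} [NormedAddCommGroup E] [NormedSpace ℂ E]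

/-- The operator on vectors indexed by sets of labels that applies `A` and adds the labels in `m`
to the index. -/
def labelled (A : E →L[ℂ] E) (m : Finset L) : (Finset L → E) →L[ℂ] (Finset L → E) :=
  ContinuousLinearMap.pi fun J => ∑ J' with J' ∪ m = J, A ∘L ContinuousLinearMap.proj J'

lemma labelled_apply (A : E →L[ℂ] E) (m : Finset L) (F : Finset L → E) (J : Finset L) :
    labelled A m F J = ∑ J' with J' ∪ m = J, A (F J') := by
  simp [labelled]

lemma labelled_single (A : E →L[ℂ] E) (m J : Finset L) (x : E) :
    labelled A m (Pi.single J x) = Pi.single (J ∪ m) (A x) := by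
  ext K
  rw [labelled_apply, Finset.sum_filter, Finset.sum_eq_single J (fun J' _ hJ' => by simp [hJ'])
    (by simp), Pi.single_eq_same, Pi.single_apply]
  simp only [eq_comm]

lemma norm_labelled_le (A : E →L[ℂ] E) (m : Finset L) :
    ‖labelled A m‖ ≤ Fintype.card (Finset L) * ‖A‖ := by
  refine ContinuousLinearMap.opNorm_le_bound _ (by positivity) fun F => ?_
  refine (pi_norm_le_iff_of_nonneg (by positivity)).2 fun J => ?_
  rw [labelled_apply]
  calc ‖∑ J' with J' ∪ m = J, A (F J')‖ ≤ ∑ J' with J' ∪ m = J, ‖A‖ * ‖F‖ :=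
        norm_sum_le_of_le _ fun J' _ => A.le_opNorm_of_le (norm_le_pi_norm F J')
    _ ≤ ∑ _J' : Finset L, ‖A‖ * ‖F‖ :=
        Finset.sum_le_sum_of_subset_of_nonneg (Finset.filter_subset _ _)
          fun _ _ _ => by positivity
    _ = Fintype.card (Finset L) * ‖A‖ * ‖F‖ := by
        rw [Finset.sum_const, Finset.card_univ, nsmul_eq_mul, mul_assoc]

lemma IsBoundedGenerator.labelled {A : ℝ → E →L[ℂ] E} {C : ℝ} (hA : IsBoundedGenerator A C)
    {m : ℝ → Finset L} (hm : ∀ ℓ, MeasurableSet {s | ℓ ∈ m s}) :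
    IsBoundedGenerator (fun s => labelled (A s) (m s)) (Fintype.card (Finset L) * C) where
  stronglyMeasurable_apply F := by
    refine stronglyMeasurable_pi fun J => ?_
    simp only [labelled_apply, Finset.sum_filter]
    refine Finset.stronglyMeasurable_fun_sum _ fun J' _ =>
      .ite (measurableSet_finset_eq (fun ℓ => ?_) J) (hA.stronglyMeasurable_apply _)
        stronglyMeasurable_const
    simp only [Finset.mem_union, Set.ofPred_or]
    exact (MeasurableSet.const _).union (hm ℓ)
  norm_le s := (norm_labelled_le _ _).trans (by gcongr; exact hA.norm_le s)

/-- The set of labels added by the operators of a time-ordered product at the times `p`. -/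
def labels {n : ℕ} (m : Fin n → ℝ → Finset L) (p : Fin n → ℝ) : Finset L :=
  Finset.univ.biUnion fun j => m j (p j)

omit [Fintype L] in
lemma labels_cons {n : ℕ} (m : Fin (n + 1) → ℝ → Finset L) (s : ℝ) (p : Fin n → ℝ) :
    labels m (Fin.cons s p) = labels (Fin.tail m) p ∪ m 0 s := by
  ext ℓ
  simp [labels, Fin.exists_fin_succ, Fin.tail, or_comm]

omit [Fintype L] in
lemma measurableSet_labels_eq [Finite L] {n : ℕ} {m : Fin n → ℝ → Finset L}
    (hm : ∀ j ℓ, MeasurableSet {s | ℓ ∈ m j s}) (J : Finset L) :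
    MeasurableSet {p | labels m p = J} := by
  refine measurableSet_finset_eq (fun ℓ => ?_) J
  simp only [labels, Finset.mem_biUnion, Finset.mem_univ, true_and, Set.ofPred_exists]
  exact MeasurableSet.iUnion fun j => (hm j ℓ).preimage (measurable_pi_apply j)

lemma timeOrderedProd_labelled_single {n : ℕ} (A : Fin n → ℝ → E →L[ℂ] E)
    (m : Fin n → ℝ → Finset L) (p : Fin n → ℝ) (x : E) :
    timeOrderedProd (fun j s => labelled (A j s) (m j s)) p (Pi.single ∅ x) =
      Pi.single (labels m p) (timeOrderedProd A p x) := by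
  induction n with
  | zero => simp [timeOrderedProd, labels]
  | succ n ih =>
    rw [← Fin.cons_self_tail p, timeOrderedProd_cons, timeOrderedProd_cons, labels_cons,
      mul_apply_eq_comp, mul_apply_eq_comp, ← labelled_single]
    exact congrArg _ (ih (Fin.tail A) (Fin.tail m) (Fin.tail p))

variable {ι : Type*} [Fintype ι]

/-- The generator of the evolution that follows the set of labels that have occurred so far. -/
def labelledGenerator (A : ι → ℝ → E →L[ℂ] E) (m : ι → ℝ → Finset L) (s : ℝ) :
    (Finset L → E) →L[ℂ] (Finset L → E) :=
  ∑ i, labelled (A i s) (m i s)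

lemma isBoundedGenerator_labelledGenerator {A : ι → ℝ → E →L[ℂ] E} {C : ι → ℝ}
    {m : ι → ℝ → Finset L} (hA : ∀ i, IsBoundedGenerator (A i) (C i))
    (hm : ∀ i ℓ, MeasurableSet {s | ℓ ∈ m i s}) :
    IsBoundedGenerator (labelledGenerator A m) (∑ i, Fintype.card (Finset L) * C i) :=
  .sum fun i => (hA i).labelled (hm i)

lemma dysonTerm_labelledGenerator_apply [CompleteSpace E] {A : ι → ℝ → E →L[ℂ] E} {C : ι → ℝ}
    {m : ι → ℝ → Finset L} (hA : ∀ i, IsBoundedGenerator (A i) (C i))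
    (hm : ∀ i ℓ, MeasurableSet {s | ℓ ∈ m i s}) (x : E) (n : ℕ) {t : ℝ} (ht : 0 ≤ t)
    (J : Finset L) :
    dysonTerm (labelledGenerator A m) (Pi.single ∅ x) n t J =
      ∑ S : Fin n → ι, ∫ p in timeSimplex n t ∩ {p | labels (fun j => m (S j)) p = J},
        timeOrderedProd (fun j => A (S j)) p x := by
  have hlab := fun i => (hA i).labelled (hm i)
  refine (congrFun (dysonTerm_sum_eq_sum_setIntegral hlab _ n ht) J).trans ?_
  rw [Finset.sum_apply]
  refine Finset.sum_congr rfl fun S _ => ?_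
  rw [eval_integral fun K => Integrable.eval
      (integrableOn_timeOrderedProd_apply (fun j => hlab (S j)) (Pi.single ∅ x) t) K,
    ← setIntegral_indicator (measurableSet_labels_eq (fun j => hm (S j)) J)]
  refine integral_congr_ae (.of_forall fun p => ?_)
  simp [timeOrderedProd_labelled_single, Pi.single_apply, Set.indicator_apply, eq_comm]

end Operator

lemma sum_pow_card_le {c : ℝ} (hc : 0 < c) (J m : Finset L) :
    ∑ J' with J' ∪ m = J ∧ J' ≠ J, c ^ J'.card ≤
      c ^ J.card * ∑ B ∈ m.powerset.erase ∅, c⁻¹ ^ B.card := by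
  have hsub : ∀ J' ∈ Finset.univ.filter fun J' => J' ∪ m = J ∧ J' ≠ J, J' ⊆ J := fun J' hJ' =>
    (Finset.mem_filter.1 hJ').2.1 ▸ Finset.subset_union_left
  have hinj : Set.InjOn (fun J' => J \ J')
      (Finset.univ.filter fun J' => J' ∪ m = J ∧ J' ≠ J : Finset (Finset L)) := by
    intro J₁ h₁ J₂ h₂ heq
    rw [← Finset.sdiff_sdiff_eq_self (hsub J₁ h₁), show J \ J₁ = J \ J₂ from heq,
      Finset.sdiff_sdiff_eq_self (hsub J₂ h₂)]
  calc ∑ J' with J' ∪ m = J ∧ J' ≠ J, c ^ J'.card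
      = ∑ J' with J' ∪ m = J ∧ J' ≠ J, c ^ J.card * c⁻¹ ^ (J \ J').card := by
        refine Finset.sum_congr rfl fun J' hJ' => ?_
        rw [← Finset.card_sdiff_add_card_eq_card (hsub J' hJ'), pow_add, inv_pow]
        field_simp
    _ = ∑ B ∈ (Finset.univ.filter fun J' => J' ∪ m = J ∧ J' ≠ J).image fun J' => J \ J',
          c ^ J.card * c⁻¹ ^ B.card :=
        (Finset.sum_image (f := fun B => c ^ J.card * c⁻¹ ^ B.card) hinj).symm
    _ ≤ ∑ B ∈ m.powerset.erase ∅, c ^ J.card * c⁻¹ ^ B.card := by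
        refine Finset.sum_le_sum_of_subset_of_nonneg (Finset.image_subset_iff.2 fun J' hJ' => ?_)
          fun _ _ _ => by positivity
        obtain ⟨hunion, hne⟩ := (Finset.mem_filter.1 hJ').2
        refine Finset.mem_erase.2 ⟨fun h => hne ((hsub J' hJ').antisymm
          (Finset.sdiff_eq_empty_iff_subset.1 h)), Finset.mem_powerset.2 ?_⟩
        rw [← hunion, Finset.union_sdiff_left]
        exact Finset.sdiff_subset
    _ = _ := (Finset.mul_sum _ _ _).symm

section Norm

variable {H : Type*} [NormedAddCommGroup H] [InnerProductSpace ℂ H]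

lemma re_inner_labelled_le {A : H →L[ℂ] H} (hA : ∀ v, (⟪v, A v⟫_ℂ).re = 0) (m J : Finset L)
    (F : Finset L → H) :
    (⟪F J, labelled A m F J⟫_ℂ).re ≤
      ‖F J‖ * (‖A‖ * ∑ J' with J' ∪ m = J ∧ J' ≠ J, ‖F J'‖) := by
  have hsplit : (⟪F J, labelled A m F J⟫_ℂ).re =
      ∑ J' with J' ∪ m = J ∧ J' ≠ J, (⟪F J, A (F J')⟫_ℂ).re := by
    rw [labelled_apply, inner_sum, Complex.re_sum, ← Finset.filter_filter]
    refine (Finset.sum_filter_of_ne ?_).symm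
    rintro J' - hne rfl
    exact hne (hA _)
  rw [hsplit, Finset.mul_sum, Finset.mul_sum]
  refine Finset.sum_le_sum fun J' _ => (Complex.re_le_norm _).trans ?_
  exact (norm_inner_le_norm _ _).trans (by gcongr; exact A.le_opNorm _)

variable {ι : Type*} [Fintype ι]

lemma re_inner_labelledGenerator_le {A : ι → ℝ → H →L[ℂ] H} {m : ι → ℝ → Finset L} {s c γ K : ℝ}
    (hskew : ∀ i v, (⟪v, A i s v⟫_ℂ).re = 0) (hc : 0 < c) (hK : 0 ≤ K)
    (hγ : ∑ i, ‖A i s‖ * ∑ B ∈ (m i s).powerset.erase ∅, c⁻¹ ^ B.card ≤ γ)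
    {F : Finset L → H} {J : Finset L} (hF : ∀ J' ⊂ J, ‖F J'‖ ≤ c ^ J'.card * K) :
    (⟪F J, labelledGenerator A m s F J⟫_ℂ).re ≤ ‖F J‖ * (c ^ J.card * K * γ) := by
  have hlower : ∀ i, ∑ J' with J' ∪ m i s = J ∧ J' ≠ J, ‖F J'‖ ≤
      c ^ J.card * K * ∑ B ∈ (m i s).powerset.erase ∅, c⁻¹ ^ B.card := fun i => by
    calc ∑ J' with J' ∪ m i s = J ∧ J' ≠ J, ‖F J'‖
        ≤ ∑ J' with J' ∪ m i s = J ∧ J' ≠ J, c ^ J'.card * K := by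
          refine Finset.sum_le_sum fun J' hJ' => hF J' ?_
          obtain ⟨hunion, hne⟩ := (Finset.mem_filter.1 hJ').2
          exact (hunion ▸ Finset.subset_union_left : J' ⊆ J).ssubset_of_ne hne
      _ ≤ (c ^ J.card * ∑ B ∈ (m i s).powerset.erase ∅, c⁻¹ ^ B.card) * K := by
          rw [← Finset.sum_mul]
          exact mul_le_mul_of_nonneg_right (sum_pow_card_le hc J _) hK
      _ = _ := by ring
  calc (⟪F J, labelledGenerator A m s F J⟫_ℂ).re
      = ∑ i, (⟪F J, labelled (A i s) (m i s) F J⟫_ℂ).re := by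
        simp only [labelledGenerator, sum_apply, Finset.sum_apply, inner_sum, Complex.re_sum]
    _ ≤ ∑ i, ‖F J‖ * (‖A i s‖ *
          (c ^ J.card * K * ∑ B ∈ (m i s).powerset.erase ∅, c⁻¹ ^ B.card)) := by
        refine Finset.sum_le_sum fun i _ => (re_inner_labelled_le (hskew i) _ J F).trans ?_
        gcongr
        exact hlower i
    _ = ‖F J‖ * (c ^ J.card * K *
          ∑ i, ‖A i s‖ * ∑ B ∈ (m i s).powerset.erase ∅, c⁻¹ ^ B.card) := by
        simp only [Finset.mul_sum, mul_left_comm]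
    _ ≤ ‖F J‖ * (c ^ J.card * K * γ) := by gcongr

theorem norm_dysonSeries_labelledGenerator_le [CompleteSpace H] {A : ι → ℝ → H →L[ℂ] H}
    {C : ι → ℝ} {m : ι → ℝ → Finset L} {c T : ℝ} {γ : ℝ → ℝ}
    (hA : ∀ i, IsBoundedGenerator (A i) (C i)) (hm : ∀ i ℓ, MeasurableSet {s | ℓ ∈ m i s})
    (hskew : ∀ i s v, (⟪v, A i s v⟫_ℂ).re = 0) (hc : 0 < c)
    (hγint : IntervalIntegrable γ volume 0 T)
    (hγ : ∀ s ∈ Set.Icc 0 T,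
      ∑ i, ‖A i s‖ * ∑ B ∈ (m i s).powerset.erase ∅, c⁻¹ ^ B.card ≤ γ s)
    (x : H) (J : Finset L) {t : ℝ} (ht : t ∈ Set.Icc 0 T) :
    ‖dysonSeries (labelledGenerator A m) (Pi.single ∅ x) t J‖ ≤
      c ^ J.card * (Real.exp (∫ s in (0 : ℝ)..t, γ s) * ‖x‖) := by
  have hG := isBoundedGenerator_labelledGenerator hA hm
  set u := dysonSeries (labelledGenerator A m) (Pi.single ∅ x)
  set Γ : ℝ → ℝ := fun t => ∫ s in (0 : ℝ)..t, γ s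
  induction J using Finset.strongInduction generalizing t with | _ J ih
  have hγt : IntervalIntegrable γ volume 0 t := hγint.mono_set <| by
    rw [Set.uIcc_of_le ht.1, Set.uIcc_of_le (ht.1.trans ht.2)]
    exact Set.Icc_subset_Icc_right ht.2
  have hw : IntervalIntegrable (fun s => c ^ J.card * ‖x‖ * (γ s * Real.exp (Γ s))) volume 0 t :=
    (intervalIntegrable_mul_exp_integral hγt).const_mul _
  have hγ₀ : ∀ s ∈ Set.Icc 0 t, 0 ≤ γ s := fun s hs =>
    (Finset.sum_nonneg fun i _ => by positivity).trans (hγ s ⟨hs.1, hs.2.trans ht.2⟩)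
  let proj : (Finset L → H) →L[ℂ] H := .proj J
  let : InnerProductSpace ℝ H := InnerProductSpace.complexToReal
  calc ‖u t J‖ ≤ ‖(Pi.single ∅ x : Finset L → H) J‖ +
        ∫ s in (0 : ℝ)..t, c ^ J.card * ‖x‖ * (γ s * Real.exp (Γ s)) := by
        refine norm_add_integral_le (u := fun τ => u τ J) ht.1
          (hG.intervalIntegrable_map_apply_dysonSeries proj _ 0 t) hw
          (fun τ _ => hG.map_dysonSeries_eq_add_integral proj _ τ) (fun s hs => ?_)
          fun s hs => ?_
        · have := hγ₀ s hs
          positivity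
        · have hsT : s ∈ Set.Icc 0 T := ⟨hs.1, hs.2.trans ht.2⟩
          rw [real_inner_eq_re_inner ℂ]
          refine (re_inner_labelledGenerator_le (fun i v => hskew i s v) hc
            (K := Real.exp (Γ s) * ‖x‖) (by positivity) (hγ s hsT)
            fun J' hJ' => ih J' hJ' hsT).trans_eq (by ring)
    _ ≤ c ^ J.card * ‖x‖ + c ^ J.card * ‖x‖ * (Real.exp (Γ t) - 1) := by
        rw [intervalIntegral.integral_const_mul, integral_mul_exp_integral hγt]
        gcongr
        rcases eq_or_ne J ∅ with rfl | hJ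
        · simp
        · simp only [Pi.single_eq_of_ne hJ, norm_zero]
          positivity
    _ = c ^ J.card * (Real.exp (Γ t) * ‖x‖) := by ring

end Norm

end Labelled

section Tuples

variable {Q : Type*} [Fintype Q] [DecidableEq Q]

lemma factorial_le_card_filter_image_cons_eq {S : Finset Q} {q : Q} {j : ℕ} (hq : q ∈ S)
    (hS : S.card = j + 1) :
    j.factorial ≤ (Finset.univ.filter fun i : Fin j → Q =>
      Function.Injective (Fin.cons q i : Fin (j + 1) → Q) ∧
        Finset.univ.image (Fin.cons q i : Fin (j + 1) → Q) = S).card := by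
  have hcard : Fintype.card (S.erase q) = j := by
    rw [Fintype.card_coe, Finset.card_erase_of_mem hq, hS, Nat.add_sub_cancel]
  have hequiv : Fintype.card (Fin j ≃ S.erase q) = j.factorial := by
    rw [Fintype.card_equiv (Fintype.equivFinOfCardEq hcard).symm, Fintype.card_fin]
  rw [← hequiv, ← Finset.card_univ]
  refine Finset.card_le_card_of_injOn (fun e a => (e a : Q)) (fun e _ => ?_)
    fun e _ e' _ heq => Equiv.ext fun a => Subtype.ext (congrFun heq a)
  have hinj : Function.Injective (Fin.cons q fun a => (e a : Q) : Fin (j + 1) → Q) := by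
    refine Fin.cons_injective_iff.2 ⟨?_, Subtype.val_injective.comp e.injective⟩
    rintro ⟨a, ha⟩
    exact (Finset.mem_erase.1 (e a).2).1 ha
  refine Finset.mem_coe.2 (Finset.mem_filter.2 ⟨Finset.mem_univ _, hinj, ?_⟩)
  refine Finset.eq_of_subset_of_card_le (Finset.image_subset_iff.2 fun a _ => ?_) ?_
  · induction a using Fin.cases with
    | zero => exact hq
    | succ a => exact Finset.mem_of_mem_erase (e a).2
  · rw [Finset.card_image_of_injective _ hinj, hS, Finset.card_univ, Fintype.card_fin]

lemma factorial_mul_sum_le_sum_injective_cons {h : Finset Q → ℝ} (h₀ : ∀ S, 0 ≤ h S) (q : Q)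
    (j : ℕ) :
    j.factorial * ∑ S with q ∈ S ∧ S.card = j + 1, h S ≤
      ∑ i : Fin j → Q with Function.Injective (Fin.cons q i : Fin (j + 1) → Q),
        h (Finset.univ.image (Fin.cons q i : Fin (j + 1) → Q)) := by
  calc (j.factorial : ℝ) * ∑ S with q ∈ S ∧ S.card = j + 1, h S
      ≤ ∑ S with q ∈ S ∧ S.card = j + 1, ∑ i : Fin j → Q with
          Function.Injective (Fin.cons q i : Fin (j + 1) → Q) ∧
            Finset.univ.image (Fin.cons q i : Fin (j + 1) → Q) = S, h S := by
        rw [Finset.mul_sum]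
        refine Finset.sum_le_sum fun S hS => ?_
        obtain ⟨hq, hcard⟩ := (Finset.mem_filter.1 hS).2
        rw [Finset.sum_const, nsmul_eq_mul]
        exact mul_le_mul_of_nonneg_right
          (by exact_mod_cast factorial_le_card_filter_image_cons_eq hq hcard) (h₀ S)
    _ ≤ ∑ S, ∑ i : Fin j → Q with
          Function.Injective (Fin.cons q i : Fin (j + 1) → Q) ∧
            Finset.univ.image (Fin.cons q i : Fin (j + 1) → Q) = S, h S :=
        Finset.sum_le_sum_of_subset_of_nonneg (Finset.filter_subset _ _) fun S _ _ =>
          Finset.sum_nonneg fun _ _ => h₀ S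
    _ = _ := by
        simp only [← Finset.filter_filter]
        exact Finset.sum_fiberwise' _ _ _

lemma sum_mul_card_sub_one_eq_sum_range (h : Finset Q → ℝ) (w : ℕ → ℝ) (q : Q) :
    ∑ S with q ∈ S, h S * w (S.card - 1) =
      ∑ j ∈ Finset.range (Fintype.card Q), (∑ S with q ∈ S ∧ S.card = j + 1, h S) * w j := by
  have hpos : ∀ S : Finset Q, q ∈ S → 0 < S.card := fun S hq => Finset.card_pos.2 ⟨q, hq⟩
  have hmaps : ∀ S ∈ Finset.univ.filter fun S : Finset Q => q ∈ S,
      S.card - 1 ∈ Finset.range (Fintype.card Q) := fun S hS => by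
    have := hpos S (Finset.mem_filter.1 hS).2
    have := S.card_le_univ
    rw [Finset.mem_range]
    omega
  rw [← Finset.sum_fiberwise_of_maps_to hmaps]
  refine Finset.sum_congr rfl fun j _ => ?_
  rw [Finset.filter_filter, Finset.sum_mul]
  refine Finset.sum_congr (Finset.filter_congr fun S _ => and_congr_right fun hq => ?_)
    fun S hS => ?_
  · have := hpos S hq
    omega
  · rw [(Finset.mem_filter.1 hS).2.2, Nat.add_sub_cancel]

end Tuples

section Struck

variable {Q L : Type*} [DecidableEq Q] {A : Finset L} {qubits : L → Finset Q} {S : Finset Q}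

lemma card_filter_not_disjoint_le
    (hdisj : (A : Set L).PairwiseDisjoint qubits) :
    (A.filter fun ℓ => ¬Disjoint (qubits ℓ) S).card ≤ S.card := by
  have hdisj' : (A.filter fun ℓ => ¬Disjoint (qubits ℓ) S : Set L).PairwiseDisjoint
      fun ℓ => qubits ℓ ∩ S := fun ℓ hℓ ℓ' hℓ' hne =>
    (hdisj (Finset.mem_filter.1 hℓ).1 (Finset.mem_filter.1 hℓ').1 hne).mono
      Finset.inter_subset_left Finset.inter_subset_left
  refine (Finset.card_le_card_biUnion hdisj' fun ℓ hℓ => ?_).trans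
    (Finset.card_le_card (Finset.biUnion_subset.2 fun ℓ _ => Finset.inter_subset_right))
  exact Finset.not_disjoint_iff_nonempty_inter.1 (Finset.mem_filter.1 hℓ).2

lemma card_filter_not_disjoint_le_sum_card_inter :
    (A.filter fun ℓ => ¬Disjoint (qubits ℓ) S).card ≤ ∑ ℓ ∈ A, (qubits ℓ ∩ S).card := by
  rw [Finset.card_filter]
  refine Finset.sum_le_sum fun ℓ _ => ?_
  split_ifs with hℓ
  · exact Nat.zero_le _
  · exact Finset.card_pos.2 (Finset.not_disjoint_iff_nonempty_inter.1 hℓ)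

/-- The weight per element of a set of at most `N + 1` elements that bounds the sum of
`x ^ #B` over its nonempty subsets `B`. -/
def subsetWeight (x : ℝ) (N : ℕ) : ℝ := 2 ^ N * ∑ k ∈ Finset.range (N + 1), x ^ (k + 1) / (k + 1)

lemma subsetWeight_nonneg {x : ℝ} (hx : 0 ≤ x) (N : ℕ) : 0 ≤ subsetWeight x N := by
  unfold subsetWeight
  positivity

lemma choose_succ_mul_le {b N : ℕ} (hb : b ≤ N + 1) (k : ℕ) :
    b.choose (k + 1) * (k + 1) ≤ b * 2 ^ N := by
  cases b with
  | zero => simp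
  | succ n =>
    rw [← Nat.add_one_mul_choose_eq]
    exact Nat.mul_le_mul_left _ ((Nat.choose_le_two_pow n k).trans
      (Nat.pow_le_pow_right two_pos (by omega)))

lemma sum_powerset_erase_empty_pow_card (B : Finset L) (x : ℝ) [DecidableEq L] :
    ∑ A ∈ B.powerset.erase ∅, x ^ A.card =
      ∑ k ∈ Finset.range B.card, B.card.choose (k + 1) * x ^ (k + 1) := by
  have hpow := Finset.sum_powerset_apply_card (fun k => x ^ k) (x := B)
  rw [Finset.sum_range_succ', ← Finset.add_sum_erase _ _ (Finset.empty_mem_powerset B)] at hpow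
  simp only [Finset.card_empty, pow_zero, Nat.choose_zero_right, one_smul, nsmul_eq_mul] at hpow
  linarith

lemma sum_powerset_erase_empty_pow_card_le [DecidableEq L] {B : Finset L} {N : ℕ}
    (hB : B.card ≤ N + 1) {x : ℝ} (hx : 0 ≤ x) :
    ∑ A ∈ B.powerset.erase ∅, x ^ A.card ≤ B.card * subsetWeight x N := by
  rw [sum_powerset_erase_empty_pow_card, subsetWeight, Finset.mul_sum, Finset.mul_sum]
  refine (Finset.sum_le_sum_of_subset_of_nonneg (Finset.range_subset_range.2 hB)
    fun _ _ _ => by positivity).trans (Finset.sum_le_sum fun k _ => ?_)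
  calc (B.card.choose (k + 1) : ℝ) * x ^ (k + 1)
      = ((B.card.choose (k + 1) * (k + 1) : ℕ) : ℝ) * (x ^ (k + 1) / (k + 1)) := by
        push_cast
        field_simp
    _ ≤ ((B.card * 2 ^ N : ℕ) : ℝ) * (x ^ (k + 1) / (k + 1)) := by
        refine mul_le_mul_of_nonneg_right ?_ (by positivity)
        exact_mod_cast choose_succ_mul_le hB k
    _ = _ := by
        push_cast
        ring

end Struck

section Series

variable {f : ℕ → ℝ} {α x : ℝ}

/-- The exponent `∑ g_k / (2 k!)` of the effective noise strength. -/
def noiseExponent (f : ℕ → ℝ) (α : ℝ) : ℝ := ∑' k : ℕ, g f α (k + 1) / (2 * (k + 1).factorial)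

lemma gTerm_nonneg (hα : 0 ≤ α) (hf : ∀ k, 1 ≤ k → 0 ≤ f k) {k : ℕ} (hk : 1 ≤ k) (l : ℕ) :
    0 ≤ gTerm f α k l := by
  have := hf (k + l) (by omega)
  unfold gTerm
  positivity

lemma noiseExponent_nonneg (hα : 0 ≤ α) (hf : ∀ k, 1 ≤ k → 0 ≤ f k) : 0 ≤ noiseExponent f α :=
  tsum_nonneg fun _ =>
    div_nonneg (tsum_nonneg (gTerm_nonneg hα hf (Nat.le_add_left 1 _))) (by positivity)

lemma sum_mul_subsetWeight_eq (f : ℕ → ℝ) (α x : ℝ) (N : ℕ) :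
    ∑ j ∈ Finset.range N, f (j + 1) * α ^ (j + 1) / j.factorial * subsetWeight x j =
      ∑ k ∈ Finset.range N, (2 * α * x) ^ (k + 1) / (2 * (k + 1).factorial) *
        ∑ l ∈ Finset.range (N - k), gTerm f α (k + 1) l := by
  calc ∑ j ∈ Finset.range N, f (j + 1) * α ^ (j + 1) / j.factorial * subsetWeight x j
      = ∑ j ∈ Finset.range N, ∑ k ∈ Finset.range (j + 1), (2 * α * x) ^ (k + 1) /
          (2 * (k + 1).factorial) * gTerm f α (k + 1) (j - k) := by
        refine Finset.sum_congr rfl fun j _ => ?_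
        rw [subsetWeight, Finset.mul_sum, Finset.mul_sum]
        refine Finset.sum_congr rfl fun k hk => ?_
        obtain ⟨l, rfl⟩ := Nat.exists_eq_add_of_le (Finset.mem_range_succ_iff.1 hk)
        simp only [gTerm, Nat.add_sub_cancel_left, Nat.add_right_comm k 1 l, Nat.add_sub_cancel,
          Nat.factorial_succ k]
        push_cast
        field_simp
        ring
    _ = _ := by
        simp only [Finset.mul_sum]
        rw [← Finset.sum_range_diag_flip N fun k l => (2 * α * x) ^ (k + 1) /
          (2 * (k + 1).factorial) * gTerm f α (k + 1) l]

lemma mul_sum_mul_subsetWeight_le (hα : 0 ≤ α) (hx : 0 ≤ x) {m : ℕ} (hmx : 2 * m * α * x ≤ 1)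
    (hf : ∀ k, 1 ≤ k → 0 ≤ f k) (hg : ∀ k, 1 ≤ k → Summable (gTerm f α k))
    (hsum : Summable fun k : ℕ => g f α (k + 1) / (2 * (k + 1).factorial)) (N : ℕ) :
    m * ∑ j ∈ Finset.range N, f (j + 1) * α ^ (j + 1) / j.factorial * subsetWeight x j ≤
      noiseExponent f α := by
  have hterm := fun k => gTerm_nonneg hα hf (Nat.le_add_left 1 k)
  rw [sum_mul_subsetWeight_eq, Finset.mul_sum]
  refine (Finset.sum_le_sum fun k _ => ?_).trans (hsum.sum_le_tsum (Finset.range N) fun k _ => ?_)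
  · have hpow : m * (2 * α * x) ^ (k + 1) ≤ 1 :=
      calc (m : ℝ) * (2 * α * x) ^ (k + 1) ≤ (m : ℝ) ^ (k + 1) * (2 * α * x) ^ (k + 1) := by
            gcongr
            exact_mod_cast Nat.le_self_pow (by omega) m
        _ = (2 * m * α * x) ^ (k + 1) := by rw [← mul_pow]; ring
        _ ≤ 1 := pow_le_one₀ (by positivity) hmx
    calc m * ((2 * α * x) ^ (k + 1) / (2 * (k + 1).factorial) *
          ∑ l ∈ Finset.range (N - k), gTerm f α (k + 1) l)
        = m * (2 * α * x) ^ (k + 1) *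
          ((∑ l ∈ Finset.range (N - k), gTerm f α (k + 1) l) / (2 * (k + 1).factorial)) := by ring
      _ ≤ 1 * (g f α (k + 1) / (2 * (k + 1).factorial)) := by
          gcongr
          · exact div_nonneg (Finset.sum_nonneg fun l _ => hterm k l) (by positivity)
          · exact (hg (k + 1) (by omega)).sum_le_tsum _ fun l _ => hterm k l
      _ = _ := one_mul _
  · exact div_nonneg (tsum_nonneg (hterm k)) (by positivity)

end Series

lemma sum_mul_sum_powerset_struck_le {Q L : Type*} [Fintype Q] [DecidableEq Q] [DecidableEq L]
    {h : Finset Q → ℝ} (h₀ : ∀ S, 0 ≤ h S) {A : Finset L} {qubits : L → Finset Q}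
    (hdisj : (A : Set L).PairwiseDisjoint qubits) {m : ℕ} (hm : ∀ ℓ ∈ A, (qubits ℓ).card ≤ m)
    {x : ℝ} (hx : 0 ≤ x) {b : ℕ → ℝ} (hb₀ : ∀ j, 0 ≤ b j)
    (hb : ∀ q j, ∑ S with q ∈ S ∧ S.card = j + 1, h S ≤ b j) :
    ∑ S, h S * ∑ B ∈ (A.filter fun ℓ => ¬Disjoint (qubits ℓ) S).powerset.erase ∅, x ^ B.card ≤
      A.card * (m * ∑ j ∈ Finset.range (Fintype.card Q), b j * subsetWeight x j) := by
  have hw := subsetWeight_nonneg hx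
  calc ∑ S, h S * ∑ B ∈ (A.filter fun ℓ => ¬Disjoint (qubits ℓ) S).powerset.erase ∅, x ^ B.card
      ≤ ∑ S, h S * ((∑ ℓ ∈ A, ((qubits ℓ ∩ S).card : ℝ)) * subsetWeight x (S.card - 1)) := by
        refine Finset.sum_le_sum fun S _ => mul_le_mul_of_nonneg_left ?_ (h₀ S)
        refine (sum_powerset_erase_empty_pow_card_le (N := S.card - 1) ?_ hx).trans
          (mul_le_mul_of_nonneg_right ?_ (hw _))
        · have := card_filter_not_disjoint_le (S := S) hdisj
          omega
        · exact_mod_cast card_filter_not_disjoint_le_sum_card_inter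
    _ = ∑ ℓ ∈ A, ∑ q ∈ qubits ℓ, ∑ S with q ∈ S, h S * subsetWeight x (S.card - 1) := by
        simp only [Finset.sum_mul, Finset.mul_sum]
        rw [Finset.sum_comm]
        refine Finset.sum_congr rfl fun ℓ _ => ?_
        simp only [Finset.sum_filter]
        rw [Finset.sum_comm]
        refine Finset.sum_congr rfl fun S _ => ?_
        rw [← Finset.sum_filter, Finset.filter_mem_eq_inter, Finset.sum_const, nsmul_eq_mul]
        ring
    _ ≤ ∑ ℓ ∈ A, ∑ _q ∈ qubits ℓ,
          ∑ j ∈ Finset.range (Fintype.card Q), b j * subsetWeight x j := by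
        refine Finset.sum_le_sum fun ℓ _ => Finset.sum_le_sum fun q _ => ?_
        rw [sum_mul_card_sub_one_eq_sum_range]
        exact Finset.sum_le_sum fun j _ => mul_le_mul_of_nonneg_right (hb q j) (hw j)
    _ ≤ ∑ _ℓ ∈ A, m * ∑ j ∈ Finset.range (Fintype.card Q), b j * subsetWeight x j := by
        refine Finset.sum_le_sum fun ℓ hℓ => ?_
        rw [Finset.sum_const, nsmul_eq_mul]
        exact mul_le_mul_of_nonneg_right (by exact_mod_cast hm ℓ hℓ)
          (Finset.sum_nonneg fun j _ => mul_nonneg (hb₀ j) (hw j))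
    _ = _ := by rw [Finset.sum_const, nsmul_eq_mul]

section FreeEvolution

variable {Q 𝓑 : Type*} [Fintype Q] [DecidableEq Q]
  [NormedAddCommGroup 𝓑] [InnerProductSpace ℂ 𝓑]

lemma ofBlocks_smul_mul_ofBlocks_smul (M N : Matrix (Bits Q) (Bits Q) ℂ) (A B : 𝓑 →L[ℂ] 𝓑) :
    ofBlocks (fun x y => M x y • A) * ofBlocks (fun x y => N x y • B) =
      ofBlocks fun x y => (M * N) x y • (A * B) := by
  ext ψ x
  simp only [mul_apply_eq_comp, ofBlocks_apply, smul_apply, map_sum, map_smul, smul_smul,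
    Matrix.mul_apply]
  rw [Finset.sum_comm]
  simp only [← Finset.sum_smul, mul_comm]

lemma ofBlocks_one_smul_one :
    ofBlocks (fun x y => (1 : Matrix (Bits Q) (Bits Q) ℂ) x y • (1 : 𝓑 →L[ℂ] 𝓑)) = 1 := by
  ext ψ x
  simp only [ofBlocks_apply, smul_apply, one_apply_eq_self]
  simp only [Matrix.one_apply, ite_smul, one_smul, zero_smul, Finset.sum_ite_eq, Finset.mem_univ,
    if_true]

lemma star_ofBlocks_smul [CompleteSpace 𝓑] (M : Matrix (Bits Q) (Bits Q) ℂ) (A : 𝓑 →L[ℂ] 𝓑) :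
    star (ofBlocks fun x y => M x y • A) = ofBlocks fun x y => star M x y • star A := by
  refine ((ContinuousLinearMap.eq_adjoint_iff _ _).2 fun φ ψ => ?_).symm
  simp only [PiLp.inner_apply, ofBlocks_apply, smul_apply, sum_inner, inner_sum, inner_smul_left,
    inner_smul_right, Matrix.star_apply, starRingEnd_apply, star_star,
    ContinuousLinearMap.star_eq_adjoint, ContinuousLinearMap.adjoint_inner_left]
  exact Finset.sum_comm

variable {U : ℝ → Matrix (Bits Q) (Bits Q) ℂ} {V : ℝ → 𝓑 →L[ℂ] 𝓑}

lemma freeEvolution_mem_unitary [CompleteSpace 𝓑] {t : ℝ}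
    (hU : U t ∈ Matrix.unitaryGroup (Bits Q) ℂ) (hV : V t ∈ unitary (𝓑 →L[ℂ] 𝓑)) :
    freeEvolution U V t ∈ unitary (Joint Q 𝓑 →L[ℂ] Joint Q 𝓑) := by
  rw [Unitary.mem_iff, freeEvolution, star_ofBlocks_smul, ofBlocks_smul_mul_ofBlocks_smul,
    ofBlocks_smul_mul_ofBlocks_smul, Matrix.mem_unitaryGroup_iff'.1 hU,
    Matrix.mem_unitaryGroup_iff.1 hU, Unitary.star_mul_self_of_mem hV,
    Unitary.mul_star_self_of_mem hV]
  exact ⟨ofBlocks_one_smul_one, ofBlocks_one_smul_one⟩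

lemma continuous_freeEvolution (hU : Continuous U) (hV : ∀ ψ, Continuous fun t => V t ψ)
    (ψ : Joint Q 𝓑) : Continuous fun t => freeEvolution U V t ψ := by
  refine (PiLp.continuous_toLp 2 (fun _ : Bits Q => 𝓑)).comp
    (f := fun t x => freeEvolution U V t ψ x) (continuous_pi fun x => ?_)
  simp only [freeEvolution, ofBlocks_apply, smul_apply]
  exact continuous_finsetSum _ fun y _ => (hU.matrix_elem x y).smul (hV _)

end FreeEvolution

section Unitary

variable {H : Type*} [NormedAddCommGroup H] [InnerProductSpace ℂ H] [CompleteSpace H]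

lemma continuous_adjoint_of_mem_unitary {W : ℝ → H →L[ℂ] H} (hW : ∀ t, W t ∈ unitary (H →L[ℂ] H))
    (hWc : ∀ ψ, Continuous fun t => W t ψ) (ψ : H) :
    Continuous fun t => ContinuousLinearMap.adjoint (W t) ψ := by
  refine continuous_iff_continuousAt.2 fun s => tendsto_iff_norm_sub_tendsto_zero.2 ?_
  have hinv : ∀ t, W t (ContinuousLinearMap.adjoint (W t) ψ) = ψ := fun t =>
    DFunLike.congr_fun (Unitary.mul_star_self_of_mem (hW t)) ψ
  have hnorm : ∀ t φ, ‖ContinuousLinearMap.adjoint (W t) ψ - φ‖ = ‖ψ - W t φ‖ := fun t φ => by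
    rw [← ContinuousLinearMap.norm_map_of_mem_unitary (hW t), map_sub, hinv]
  simp only [hnorm]
  refine (Continuous.tendsto' (by fun_prop) s _ ?_)
  rw [hinv, sub_self, norm_zero]

lemma re_inner_neg_I_smul_eq_zero {A : H →L[ℂ] H} (hA : IsSelfAdjoint A) (v : H) :
    (⟪v, ((-Complex.I) • A) v⟫_ℂ).re = 0 := by
  have him : (⟪v, A v⟫_ℂ).im = 0 := by
    rw [← Complex.conj_eq_iff_im, inner_conj_symm]
    exact hA.isSymmetric v v
  rw [smul_apply, inner_smul_right]
  simp [him]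

end Unitary

section IndicatorIco

variable {a b : ℝ}

lemma integrable_indicator_Ico_one : Integrable ((Set.Ico a b).indicator (1 : ℝ → ℝ)) :=
  (integrable_indicator_iff measurableSet_Ico).2 (integrableOn_const measure_Ico_lt_top.ne)

lemma integral_indicator_Ico_one_le {T : ℝ} (hab : a ≤ b) (hT : 0 ≤ T) :
    ∫ s in (0 : ℝ)..T, (Set.Ico a b).indicator 1 s ≤ b - a := by
  rw [intervalIntegral.integral_of_le hT]
  calc ∫ s in Set.Ioc 0 T, (Set.Ico a b).indicator (1 : ℝ → ℝ) s
      ≤ ∫ s, (Set.Ico a b).indicator (1 : ℝ → ℝ) s :=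
        setIntegral_le_integral integrable_indicator_Ico_one
          (.of_forall fun s => Set.indicator_nonneg (fun _ _ => zero_le_one) s)
    _ = b - a := by
        rw [integral_indicator_one measurableSet_Ico, Real.volume_real_Ico_of_le hab]

end IndicatorIco

section Noise

variable {Q Loc 𝓑 : Type*} [Fintype Q] [DecidableEq Q]

namespace Circuit

lemma duration_le_maxDuration [Finite Loc] (C : Circuit Q Loc) (ℓ : Loc) :
    C.endTime ℓ - C.startTime ℓ ≤ C.maxDuration :=
  le_ciSup (f := fun ℓ => C.endTime ℓ - C.startTime ℓ) (Set.finite_range _).bddAbove ℓ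

lemma maxDuration_pos [Finite Loc] [Nonempty Loc] (C : Circuit Q Loc) : 0 < C.maxDuration := by
  obtain ⟨ℓ⟩ := ‹Nonempty Loc›
  exact (sub_pos.2 (C.startTime_lt_endTime ℓ)).trans_le (C.duration_le_maxDuration ℓ)

lemma T_nonneg [Nonempty Loc] (C : Circuit Q Loc) : 0 ≤ C.T := by
  obtain ⟨ℓ⟩ := ‹Nonempty Loc›
  exact ((C.startTime_nonneg ℓ).trans (C.startTime_lt_endTime ℓ).le).trans (C.endTime_le ℓ)

/-- The locations in `I` that are being executed at time `s`. -/
def activeLocations (C : Circuit Q Loc) (I : Finset Loc) (s : ℝ) : Finset I :=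
  Finset.univ.filter fun ℓ => s ∈ Set.Ico (C.startTime ℓ) (C.endTime ℓ)

/-- The locations in `I` that become faulty when a coupling term acts on the qubits `S` at
time `s`. -/
def struckLocations (C : Circuit Q Loc) (I : Finset Loc) (S : Finset Q) (s : ℝ) : Finset I :=
  (C.activeLocations I s).filter fun ℓ => ¬Disjoint (C.qubits ℓ) S

lemma pairwiseDisjoint_qubits_activeLocations (C : Circuit Q Loc) (I : Finset Loc) (s : ℝ) :
    (C.activeLocations I s : Set I).PairwiseDisjoint fun ℓ => C.qubits ℓ := by
  intro ℓ hℓ ℓ' hℓ' hne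
  by_contra hoverlap
  exact Set.disjoint_left.1 (C.disjoint ℓ ℓ' (Subtype.coe_injective.ne hne) hoverlap)
    (Finset.mem_filter.1 hℓ).2 (Finset.mem_filter.1 hℓ').2

lemma card_activeLocations (C : Circuit Q Loc) (I : Finset Loc) (s : ℝ) :
    ((C.activeLocations I s).card : ℝ) =
      ∑ ℓ : I, (Set.Ico (C.startTime ℓ) (C.endTime ℓ)).indicator 1 s := by
  simp only [activeLocations, Finset.card_filter, Set.indicator_apply, Pi.one_apply, Nat.cast_sum,
    Nat.cast_ite, Nat.cast_one, Nat.cast_zero]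

lemma intervalIntegrable_card_activeLocations (C : Circuit Q Loc) (I : Finset Loc) (a b : ℝ) :
    IntervalIntegrable (fun s => ((C.activeLocations I s).card : ℝ)) volume a b := by
  simp only [card_activeLocations]
  exact (integrable_finsetSum _ fun ℓ _ => integrable_indicator_Ico_one).intervalIntegrable

lemma integral_card_activeLocations_le [Finite Loc] (C : Circuit Q Loc) (I : Finset Loc) {t : ℝ}
    (ht : 0 ≤ t) :
    ∫ s in (0 : ℝ)..t, ((C.activeLocations I s).card : ℝ) ≤ I.card * C.maxDuration := by
  simp only [card_activeLocations]
  rw [intervalIntegral.integral_finsetSum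
    fun ℓ _ => integrable_indicator_Ico_one.intervalIntegrable]
  calc ∑ ℓ : I, ∫ s in (0 : ℝ)..t, (Set.Ico (C.startTime ℓ) (C.endTime ℓ)).indicator 1 s
      ≤ ∑ _ℓ : I, C.maxDuration := Finset.sum_le_sum fun ℓ _ =>
        (integral_indicator_Ico_one_le (C.startTime_lt_endTime ℓ).le ht).trans
          (C.duration_le_maxDuration ℓ)
    _ = I.card * C.maxDuration := by simp

lemma measurableSet_mem_struckLocations (C : Circuit Q Loc) (I : Finset Loc) (S : Finset Q)
    (ℓ : I) : MeasurableSet {s | ℓ ∈ C.struckLocations I S s} := by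
  simp only [struckLocations, activeLocations, Finset.mem_filter, Finset.mem_univ, true_and,
    Set.ofPred_and]
  exact measurableSet_Ico.inter (.const _)

lemma faultyTimes_eq [DecidableEq Loc] (C : Circuit Q Loc) (I : Finset Loc) {n : ℕ}
    (S : Fin n → {S : Finset Q // S.Nonempty}) :
    C.faultyTimes I S = timeSimplex n C.T ∩
      {p | labels (fun j => C.struckLocations I (S j)) p = Finset.univ} := by
  ext p
  refine and_congr_right fun _ => ?_
  rw [Set.mem_ofPred_eq, Finset.eq_univ_iff_forall, Subtype.forall]
  simp [IsFaulty, labels, struckLocations, activeLocations, Finset.not_disjoint_iff]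

end Circuit

variable [NormedAddCommGroup 𝓑] [InnerProductSpace ℂ 𝓑] [CompleteSpace 𝓑]

namespace NoisyComputation

lemma sum_norm_coupling_le [Finite Loc] [Nonempty Loc] (M : NoisyComputation Q Loc 𝓑) {j : ℕ}
    {r : ℝ} (hr : 0 ≤ r) (hstrength : M.strength (j + 1) ≤ ENNReal.ofReal r) (q : Q) {t : ℝ}
    (ht : t ∈ Set.Icc 0 M.T) :
    ∑ S with q ∈ S ∧ S.card = j + 1, ‖M.coupling S t‖ ≤ r / M.maxDuration / j.factorial := by
  have ht₀ := M.maxDuration_pos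
  have htuple :
      ∑ i : Fin j → Q, ‖M.tupleCoupling (j + 1) (Fin.cons q i) t‖ * M.maxDuration ≤ r := by
    have hle := (le_iSup₂ (f := fun (i₁ : Q) (t : Set.Icc (0 : ℝ) M.T) => ∑ i : Fin j → Q,
      ‖M.tupleCoupling (j + 1) (Fin.cons i₁ i) t‖ₑ * ENNReal.ofReal M.maxDuration)
      q ⟨t, ht⟩).trans hstrength
    simp only [← ofReal_norm, ← ENNReal.ofReal_mul (norm_nonneg _)] at hle
    rwa [← ENNReal.ofReal_sum_of_nonneg (fun _ _ => by positivity),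
      ENNReal.ofReal_le_ofReal_iff hr] at hle
  have hcoupling : ∑ i : Fin j → Q, ‖M.tupleCoupling (j + 1) (Fin.cons q i) t‖ =
      ∑ i : Fin j → Q with Function.Injective (Fin.cons q i : Fin (j + 1) → Q),
        ‖M.coupling (Finset.univ.image (Fin.cons q i : Fin (j + 1) → Q)) t‖ := by
    simp only [Finset.sum_filter, tupleCoupling, apply_ite norm, norm_zero]
  rw [le_div_iff₀' (by positivity), le_div_iff₀ ht₀]
  rw [← Finset.sum_mul, hcoupling] at htuple
  exact (mul_le_mul_of_nonneg_right
    (factorial_mul_sum_le_sum_injective_cons (fun _ => norm_nonneg _) q j) ht₀.le).trans htuple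

lemma exists_norm_coupling_le [Finite Loc] [Nonempty Loc] (M : NoisyComputation Q Loc 𝓑)
    {r : ℕ → ℝ} (hr : ∀ k, 1 ≤ k → 0 ≤ r k)
    (hstrength : ∀ k, 1 ≤ k → M.strength k ≤ ENNReal.ofReal (r k)) :
    ∃ b, 0 ≤ b ∧ ∀ S : Finset Q, S.Nonempty → ∀ t ∈ Set.Icc 0 M.T, ‖M.coupling S t‖ ≤ b := by
  have ht₀ := M.maxDuration_pos
  have hb₀ : ∀ j, 0 ≤ r (j + 1) / M.maxDuration / j.factorial := fun j => by
    have := hr (j + 1) (by omega)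
    positivity
  refine ⟨∑ j ∈ Finset.range (Fintype.card Q), r (j + 1) / M.maxDuration / j.factorial,
    Finset.sum_nonneg fun j _ => hb₀ j, fun S hS t ht => ?_⟩
  obtain ⟨j, hj⟩ := Nat.exists_eq_add_one.2 hS.card_pos
  have hj_mem : j ∈ Finset.range (Fintype.card Q) :=
    Finset.mem_range.2 (by have := S.card_le_univ; omega)
  obtain ⟨q, hq⟩ := hS
  calc ‖M.coupling S t‖ ≤ ∑ S' with q ∈ S' ∧ S'.card = j + 1, ‖M.coupling S' t‖ :=
        Finset.single_le_sum (f := fun S' => ‖M.coupling S' t‖) (fun _ _ => norm_nonneg _)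
          (Finset.mem_filter.2 ⟨Finset.mem_univ _, hq, hj⟩)
    _ ≤ r (j + 1) / M.maxDuration / j.factorial :=
        M.sum_norm_coupling_le (hr _ (by omega)) (hstrength _ (by omega)) q ht
    _ ≤ ∑ j ∈ Finset.range (Fintype.card Q), r (j + 1) / M.maxDuration / j.factorial :=
        Finset.single_le_sum (f := fun j => r (j + 1) / M.maxDuration / j.factorial)
          (fun j _ => hb₀ j) hj_mem

variable (M : NoisyComputation Q Loc 𝓑) {W : ℝ → Joint Q 𝓑 →L[ℂ] Joint Q 𝓑}

/-- The contribution `-i H_S(s)` of the coupling term `S` to the generator of the evolution in the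
interaction picture, set to `0` outside of `[0, T]`, where the coupling need not be bounded. -/
def interactionGenerator (W : ℝ → Joint Q 𝓑 →L[ℂ] Joint Q 𝓑) (S : Finset Q) :
    ℝ → Joint Q 𝓑 →L[ℂ] Joint Q 𝓑 :=
  (Set.Icc 0 M.T).indicator fun s => (-Complex.I) • M.interaction W S s

lemma interactionGenerator_of_mem {s : ℝ} (hs : s ∈ Set.Icc 0 M.T) (S : Finset Q) :
    M.interactionGenerator W S s = (-Complex.I) • M.interaction W S s :=
  Set.indicator_of_mem hs _

lemma interactionGenerator_of_notMem {s : ℝ} (hs : s ∉ Set.Icc 0 M.T) (S : Finset Q) :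
    M.interactionGenerator W S s = 0 :=
  Set.indicator_of_notMem hs _

lemma re_inner_interactionGenerator_eq_zero (S : Finset Q) (s : ℝ) (v : Joint Q 𝓑) :
    (⟪v, M.interactionGenerator W S s v⟫_ℂ).re = 0 := by
  by_cases hs : s ∈ Set.Icc 0 M.T
  · rw [M.interactionGenerator_of_mem hs]
    exact re_inner_neg_I_smul_eq_zero ((M.coupling_selfAdjoint S s).adjoint_conj _) v
  · simp [M.interactionGenerator_of_notMem hs]

lemma insertions_apply_eq {n : ℕ} (S : Fin n → {S : Finset Q // S.Nonempty}) {p : Fin n → ℝ}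
    (hp : p ∈ timeSimplex n M.T) (ψ : Joint Q 𝓑) :
    M.insertions W S p ψ =
      W M.T (timeOrderedProd (fun j => M.interactionGenerator W (S j)) p ψ) := by
  simp only [timeOrderedProd, fun j => M.interactionGenerator_of_mem (W := W) (hp.2 j) (S j)]
  rfl

lemma norm_interactionGenerator_le (hW : ∀ t, W t ∈ unitary (Joint Q 𝓑 →L[ℂ] Joint Q 𝓑))
    (S : Finset Q) (s : ℝ) : ‖M.interactionGenerator W S s‖ ≤ ‖M.coupling S s‖ := by
  refine (norm_indicator_le_norm_self _ _).trans_eq ?_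
  rw [norm_smul, norm_neg, Complex.norm_I, one_mul]
  exact (CStarRing.norm_mem_unitary_mul _ (Unitary.star_mem (hW s))).trans
    (CStarRing.norm_mul_mem_unitary _ (hW s))

lemma isBoundedGenerator_interactionGenerator
    (hW : ∀ t, W t ∈ unitary (Joint Q 𝓑 →L[ℂ] Joint Q 𝓑))
    (hWc : ∀ ψ, Continuous fun t => W t ψ) {S : Finset Q} {b : ℝ} (hb₀ : 0 ≤ b)
    (hb : ∀ t ∈ Set.Icc 0 M.T, ‖M.coupling S t‖ ≤ b) :
    IsBoundedGenerator (M.interactionGenerator W S) b where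
  stronglyMeasurable_apply ψ := by
    have hinteraction : StronglyMeasurable fun s => M.interaction W S s ψ :=
      stronglyMeasurable_clm_apply
        (fun v => (continuous_adjoint_of_mem_unitary hW hWc v).stronglyMeasurable)
        (stronglyMeasurable_clm_apply (M.coupling_measurable S) (hWc ψ).stronglyMeasurable)
    have hindicator : (fun s => M.interactionGenerator W S s ψ) =
        (Set.Icc 0 M.T).indicator fun s => (-Complex.I) • M.interaction W S s ψ := by
      funext s
      by_cases hs : s ∈ Set.Icc 0 M.T
      · rw [M.interactionGenerator_of_mem hs, Set.indicator_of_mem hs, smul_apply]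
      · rw [M.interactionGenerator_of_notMem hs, Set.indicator_of_notMem hs, zero_apply]
    rw [hindicator]
    exact (hinteraction.const_smul (-Complex.I)).indicator measurableSet_Icc
  norm_le s := by
    by_cases hs : s ∈ Set.Icc 0 M.T
    · exact (M.norm_interactionGenerator_le hW S s).trans (hb s hs)
    · rwa [M.interactionGenerator_of_notMem hs, norm_zero]

variable [DecidableEq Loc] {b : ℝ}

/-- The sum `E(I)` of the terms of the expansion in which every location in `I` is faulty, as the
component labelled by all of `I` of the evolution that follows the set of faulty locations. -/
def faultOperator
    (hA : ∀ S : {S : Finset Q // S.Nonempty}, IsBoundedGenerator (M.interactionGenerator W S) b)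
    (I : Finset Loc) : Joint Q 𝓑 →L[ℂ] Joint Q 𝓑 :=
  W M.T ∘L ContinuousLinearMap.proj (φ := fun _ : Finset I => Joint Q 𝓑) Finset.univ ∘L
    (isBoundedGenerator_labelledGenerator hA fun S =>
      M.measurableSet_mem_struckLocations I S).evolutionOperator M.T ∘L
    ContinuousLinearMap.single ℂ (fun _ : Finset I => Joint Q 𝓑) ∅

variable
  (hA : ∀ S : {S : Finset Q // S.Nonempty}, IsBoundedGenerator (M.interactionGenerator W S) b)
  (I : Finset Loc)

lemma faultOperator_apply (ψ : Joint Q 𝓑) :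
    M.faultOperator hA I ψ = W M.T (dysonSeries (labelledGenerator
      (fun S : {S : Finset Q // S.Nonempty} => M.interactionGenerator W S)
      fun S => M.struckLocations I S) (Pi.single ∅ ψ) M.T Finset.univ) :=
  rfl

lemma isFaultSum_faultOperator (hT : 0 ≤ M.T) : M.IsFaultSum W I (M.faultOperator hA I) := by
  have hm := fun S : {S : Finset Q // S.Nonempty} => M.measurableSet_mem_struckLocations I S
  have hmeas : ∀ (n : ℕ) (S : Fin n → {S : Finset Q // S.Nonempty}),
      MeasurableSet (M.faultyTimes I S) := fun n S => by
    rw [M.faultyTimes_eq]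
    exact (isClosed_timeSimplex n M.T).measurableSet.inter
      (measurableSet_labels_eq (fun j => hm (S j)) _)
  have hprod : ∀ (n : ℕ) (S : Fin n → {S : Finset Q // S.Nonempty}) (ψ : Joint Q 𝓑),
      IntegrableOn (fun p => timeOrderedProd (fun j => M.interactionGenerator W (S j)) p ψ)
        (M.faultyTimes I S) := fun n S ψ =>
    (integrableOn_timeOrderedProd_apply (fun j => hA (S j)) ψ M.T).mono_set fun _ hp => hp.1
  have hinsertions := fun (n : ℕ) (S : Fin n → {S : Finset Q // S.Nonempty}) (ψ : Joint Q 𝓑)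
    (p : Fin n → ℝ) (hp : p ∈ M.faultyTimes I S) => M.insertions_apply_eq (W := W) S hp.1 ψ
  refine ⟨fun n S ψ => (integrableOn_congr_fun (hinsertions n S ψ) (hmeas n S)).2
    ((W M.T).integrable_comp (hprod n S ψ)), fun ψ => ?_⟩
  have hsum := (W M.T).hasSum (Pi.hasSum.1
    ((isBoundedGenerator_labelledGenerator hA hm).hasSum_dysonTerm (Pi.single ∅ ψ) M.T)
    Finset.univ)
  rw [faultOperator_apply]
  refine hsum.congr_fun fun n => ?_
  rw [dysonTerm_labelledGenerator_apply hA hm ψ n hT, map_sum]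
  refine Finset.sum_congr rfl fun S _ => ?_
  rw [setIntegral_congr_fun (hmeas n S) (hinsertions n S ψ),
    (W M.T).integral_comp_comm (hprod n S ψ), M.faultyTimes_eq]

section NoiseStrength

variable [Finite Loc] [Nonempty Loc] {m : ℕ} {α c : ℝ} {f : ℕ → ℝ}
  (hm : ∀ ℓ, (M.qubits ℓ).card ≤ m) (hα : 0 ≤ α) (hf : ∀ k, 1 ≤ k → 0 ≤ f k)
  (hstrength : ∀ k, 1 ≤ k → M.strength k ≤ ENNReal.ofReal (f k * α ^ k))
  (hg : ∀ k, 1 ≤ k → Summable (gTerm f α k))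
  (hsum : Summable fun k : ℕ => g f α (k + 1) / (2 * (k + 1).factorial))
  (hW : ∀ t, W t ∈ unitary (Joint Q 𝓑 →L[ℂ] Joint Q 𝓑))

include hm hα hf hstrength hg hsum

lemma sum_norm_coupling_mul_le (hc₀ : 0 < c) (hc : 2 * m * α ≤ c) {s : ℝ}
    (hs : s ∈ Set.Icc 0 M.T) :
    ∑ S, ‖M.coupling S s‖ * ∑ B ∈ (M.struckLocations I S s).powerset.erase ∅, c⁻¹ ^ B.card ≤
      (M.activeLocations I s).card * (noiseExponent f α / M.maxDuration) := by
  have ht₀ := M.maxDuration_pos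
  have hr : ∀ k, 1 ≤ k → 0 ≤ f k * α ^ k := fun k hk => mul_nonneg (hf k hk) (by positivity)
  have hb₀ : ∀ j : ℕ, 0 ≤ f (j + 1) * α ^ (j + 1) / M.maxDuration / j.factorial := fun j => by
    have := hr (j + 1) (by omega)
    positivity
  refine (sum_mul_sum_powerset_struck_le (fun _ => norm_nonneg _)
    (M.pairwiseDisjoint_qubits_activeLocations I s) (fun ℓ _ => hm ℓ) (inv_nonneg.2 hc₀.le) hb₀
    fun q j => M.sum_norm_coupling_le (hr _ (by omega)) (hstrength _ (by omega)) q hs).trans ?_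
  gcongr
  rw [le_div_iff₀' ht₀]
  refine le_trans (le_of_eq ?_) (mul_sum_mul_subsetWeight_le hα (inv_nonneg.2 hc₀.le)
    (mul_inv_le_one_of_le₀ hc hc₀.le) hf hg hsum (Fintype.card Q))
  simp only [Finset.mul_sum]
  refine Finset.sum_congr rfl fun j _ => ?_
  field_simp

include hW

lemma sum_norm_interactionGenerator_mul_le (hc₀ : 0 < c) (hc : 2 * m * α ≤ c) {s : ℝ}
    (hs : s ∈ Set.Icc 0 M.T) :
    ∑ S : {S : Finset Q // S.Nonempty}, ‖M.interactionGenerator W S s‖ *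
        ∑ B ∈ (M.struckLocations I S s).powerset.erase ∅, c⁻¹ ^ B.card ≤
      (M.activeLocations I s).card * (noiseExponent f α / M.maxDuration) := by
  have hpow : ∀ S, 0 ≤ ∑ B ∈ (M.struckLocations I S s).powerset.erase ∅, c⁻¹ ^ B.card :=
    fun S => by positivity
  calc ∑ S : {S : Finset Q // S.Nonempty}, ‖M.interactionGenerator W S s‖ *
        ∑ B ∈ (M.struckLocations I S s).powerset.erase ∅, c⁻¹ ^ B.card
      = ∑ S with S.Nonempty, ‖M.interactionGenerator W S s‖ *
          ∑ B ∈ (M.struckLocations I S s).powerset.erase ∅, c⁻¹ ^ B.card :=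
        (Finset.sum_subtype _ (by simp) fun S => ‖M.interactionGenerator W S s‖ *
          ∑ B ∈ (M.struckLocations I S s).powerset.erase ∅, c⁻¹ ^ B.card).symm
    _ ≤ ∑ S, ‖M.interactionGenerator W S s‖ *
          ∑ B ∈ (M.struckLocations I S s).powerset.erase ∅, c⁻¹ ^ B.card :=
        Finset.sum_le_sum_of_subset_of_nonneg (Finset.filter_subset _ _)
          fun S _ _ => mul_nonneg (norm_nonneg _) (hpow S)
    _ ≤ ∑ S, ‖M.coupling S s‖ *
          ∑ B ∈ (M.struckLocations I S s).powerset.erase ∅, c⁻¹ ^ B.card :=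
        Finset.sum_le_sum fun S _ => mul_le_mul_of_nonneg_right
          (M.norm_interactionGenerator_le hW S s) (hpow S)
    _ ≤ (M.activeLocations I s).card * (noiseExponent f α / M.maxDuration) :=
        M.sum_norm_coupling_mul_le I hm hα hf hstrength hg hsum hc₀ hc hs

lemma norm_faultOperator_apply_le (hc₀ : 0 < c) (hc : 2 * m * α ≤ c) (ψ : Joint Q 𝓑) :
    ‖M.faultOperator hA I ψ‖ ≤ (c * Real.exp (noiseExponent f α)) ^ I.card * ‖ψ‖ := by
  have ht₀ := M.maxDuration_pos
  have hT := M.T_nonneg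
  have hintegral : ∫ s in (0 : ℝ)..M.T,
      (M.activeLocations I s).card * (noiseExponent f α / M.maxDuration) ≤
        I.card * noiseExponent f α := by
    rw [intervalIntegral.integral_mul_const]
    calc (∫ s in (0 : ℝ)..M.T, ((M.activeLocations I s).card : ℝ)) *
          (noiseExponent f α / M.maxDuration)
        ≤ I.card * M.maxDuration * (noiseExponent f α / M.maxDuration) :=
          mul_le_mul_of_nonneg_right (M.integral_card_activeLocations_le I hT)
            (div_nonneg (noiseExponent_nonneg hα hf) ht₀.le)
      _ = I.card * noiseExponent f α := by field_simp
  rw [faultOperator_apply, ContinuousLinearMap.norm_map_of_mem_unitary (hW M.T)]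
  refine (norm_dysonSeries_labelledGenerator_le hA
    (fun S => M.measurableSet_mem_struckLocations I S)
    (fun S => M.re_inner_interactionGenerator_eq_zero S) hc₀
    ((M.intervalIntegrable_card_activeLocations I 0 M.T).mul_const _)
    (fun s => M.sum_norm_interactionGenerator_mul_le I hm hα hf hstrength hg hsum hW hc₀ hc)
    ψ Finset.univ (Set.right_mem_Icc.2 hT)).trans ?_
  rw [Finset.card_univ, Fintype.card_coe, mul_pow, ← Real.exp_nat_mul, ← mul_assoc]
  gcongr

lemma norm_faultOperator_le :
    ‖M.faultOperator hA I‖ ≤ (2 * m * α * Real.exp (noiseExponent f α)) ^ I.card := by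
  have hbound : ∀ c, 2 * m * α < c →
      ‖M.faultOperator hA I‖ ≤ (c * Real.exp (noiseExponent f α)) ^ I.card := fun c hc => by
    have hc₀ : 0 < c := lt_of_le_of_lt (by positivity) hc
    exact ContinuousLinearMap.opNorm_le_bound _ (by positivity)
      (M.norm_faultOperator_apply_le hA I hm hα hf hstrength hg hsum hW hc₀ hc.le)
  have hlim : Filter.Tendsto (fun c => (c * Real.exp (noiseExponent f α)) ^ I.card)
      (nhdsWithin (2 * m * α) (Set.Ioi (2 * m * α)))
      (nhds ((2 * m * α * Real.exp (noiseExponent f α)) ^ I.card)) :=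
    (Continuous.tendsto (by fun_prop) _).mono_left nhdsWithin_le_nhds
  exact ge_of_tendsto hlim (Filter.eventually_of_mem self_mem_nhdsWithin hbound)

end NoiseStrength

end NoisyComputation

end Noise

end CorrelatedNoise

end

theorem theorem1_general {Q Loc 𝓑 : Type*} [Fintype Q] [DecidableEq Q] [Finite Loc] [Nonempty Loc]
    [NormedAddCommGroup 𝓑] [InnerProductSpace ℂ 𝓑] [CompleteSpace 𝓑]
    (M : CorrelatedNoise.NoisyComputation Q Loc 𝓑)
    (W : ℝ → CorrelatedNoise.Joint Q 𝓑 →L[ℂ] CorrelatedNoise.Joint Q 𝓑)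
    (hW : ∀ t, W t ∈ unitary (CorrelatedNoise.Joint Q 𝓑 →L[ℂ] CorrelatedNoise.Joint Q 𝓑))
    (hWc : ∀ ψ, Continuous fun t => W t ψ)
    (m : ℕ) (hm : ∀ ℓ, (M.qubits ℓ).card ≤ m)
    (α : ℝ) (hα : 0 ≤ α) (f : ℕ → ℝ) (hf : ∀ k, 1 ≤ k → 0 ≤ f k)
    (hstrength : ∀ k, 1 ≤ k → M.strength k ≤ ENNReal.ofReal (f k * α ^ k))
    (hg : ∀ k, 1 ≤ k → Summable (CorrelatedNoise.gTerm f α k))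
    (hsum : Summable (fun k : ℕ =>
      CorrelatedNoise.g f α (k + 1) / (2 * ((k + 1).factorial : ℝ)))) :
    M.HasEffectiveNoiseStrength W (2 * m * α * Real.exp (∑' k : ℕ,
      CorrelatedNoise.g f α (k + 1) / (2 * ((k + 1).factorial : ℝ)))) := by
  classical
  obtain ⟨b, hb₀, hb⟩ := M.exists_norm_coupling_le
    (fun k hk => mul_nonneg (hf k hk) (pow_nonneg hα k)) hstrength
  have hA : ∀ S : {S : Finset Q // S.Nonempty},
      CorrelatedNoise.IsBoundedGenerator (M.interactionGenerator W S) b := fun S =>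
    M.isBoundedGenerator_interactionGenerator hW hWc hb₀ (hb S S.2)
  exact fun I => ⟨M.faultOperator hA I, M.isFaultSum_faultOperator hA I M.T_nonneg,
    M.norm_faultOperator_le hA I hm hα hf hstrength hg hsum hW⟩

theorem theorem1 {Q Loc 𝓑 : Type*} [Fintype Q] [DecidableEq Q] [Fintype Loc] [Nonempty Loc]
    [NormedAddCommGroup 𝓑] [InnerProductSpace ℂ 𝓑] [CompleteSpace 𝓑]
    (M : CorrelatedNoise.NoisyComputation Q Loc 𝓑)
    (U : ℝ → Matrix (CorrelatedNoise.Bits Q) (CorrelatedNoise.Bits Q) ℂ)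
    (hU : CorrelatedNoise.IsSystemEvolution M.hamiltonian U)
    (V : ℝ → 𝓑 →L[ℂ] 𝓑)
    (hV : CorrelatedNoise.IsBathEvolution M.bath V)
    (m : ℕ) (hm : ∀ ℓ, (M.qubits ℓ).card ≤ m)
    (α : ℝ) (hα : 0 ≤ α) (f : ℕ → ℝ) (hf : ∀ k, 1 ≤ k → 0 ≤ f k)
    (hstrength : ∀ k, 1 ≤ k → M.strength k ≤ ENNReal.ofReal (f k * α ^ k))
    (hg : ∀ k, 1 ≤ k → Summable (CorrelatedNoise.gTerm f α k))
    (hsum : Summable (fun k : ℕ =>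
      CorrelatedNoise.g f α (k + 1) / (2 * ((k + 1).factorial : ℝ)))) :
    M.HasEffectiveNoiseStrength (CorrelatedNoise.freeEvolution U V)
      (2 * m * α * Real.exp (∑' k : ℕ,
        CorrelatedNoise.g f α (k + 1) / (2 * ((k + 1).factorial : ℝ)))) :=
  theorem1_general M _
    (fun t => CorrelatedNoise.freeEvolution_mem_unitary (hU.unitary t) (hV.unitary t))
    (CorrelatedNoise.continuous_freeEvolution hU.continuous hV.continuous)
    m hm α hα f hf hstrength hg hsum
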